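/- A \emph{Belyi graph} is a finite connected bicolored (white/black vertices, every edge joining a white vertex to a black one) 3-valent graph, multiple edges allowed, whose edges are properly colored red, green and blue, so that every vertex is incident to exactly one edge of each color; its ribbon structure is the one determined by the colors (cyclic order blue-green-red at white and red-green-blue at black vertices). Belyi graphs correspond to Belyi pairs $(C,f)$, i.e. to Grothendieck's dessins d'enfants. Isomorphisms and automorphisms are graph isomorphisms respecting the colors of vertices and edges. The degree $d$ of a Belyi graph is its number of white vertices (equivalently, of green edges). It has type $(k,l;m_1,m_2,\dots)$ if it has $k$ red-green cycles, $l$ green-blue cycles and, for each $i\ge1$, $m_i$ red-blue cycles of length $2i$ (these are the numbers of preimages of $0$ and of $1$ and the ramification profile over $\infty$ of the corresponding cover). Let $$F(s,u,v,t_1,t_2,\dots)=\sum_{\Gamma}\frac{1}{|\mathrm{Aut}(\Gamma)|}\,s^d u^k v^l t_1^{m_1}t_2^{m_2}\cdots\in\mathbb Q[[s,u,v,t_1,t_2,\dots]],$$ where the sum is over all isomorphism classes of Belyi graphs $\Gamma$, $d$ being the degree and $(k,l;m_1,m_2,\dots)$ the type of $\Gamma$. For a formal power series $G\in\mathbb Q[[s,u,v,t_1,t_2,\dots]]$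 put $$L_1G=\sum_{i\ge2}(i-1)\,t_i\,\frac{\partial G}{\partial t_{i-1}},$$ $$M_1G=\sum_{i\ge2}\sum_{j=1}^{i-1}\Big((i-1)\,t_jt_{i-j}\,\frac{\partial G}{\partial t_{i-1}}+j(i-j)\,t_{i+1}\,\frac{\partial^2G}{\partial t_j\,\partial t_{i-j}}\Big),$$ $$Q_1G=\sum_{i\ge2}\sum_{j=1}^{i-1}j(i-j)\,t_{i+1}\,\frac{\partial G}{\partial t_j}\cdot\frac{\partial G}{\partial t_{i-j}}.$$ \textbf{Theorem.} The series $F$ satisfies the evolution equation $$\frac{\partial F}{\partial s}=\big((u+v)L_1+M_1+Q_1\big)F+uv\,t_1,$$ and it is uniquely determined by this equation and the initial condition $F|_{s=0}=0$: one has $F|_{s=0}=0$, and every $G\in\mathbb Q[[s,u,v,t_1,t_2,\dots]]$ that satisfies the same equation with $G|_{s=0}=0$ equals $F$. Equivalently, the partition function $Z=e^F$ is given by $$Z=e^{s((u+v)L_1+M_1+uvt_1)}\,1=\sum_{n\ge0}\frac1{n!}\big(s((u+v)L_1+M_1+uvt_1)\big)^n\,1,$$ where $uvt_1$ acts by multiplication;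 that is, this formula holds for $F$, and a series $G$ with $G|_{s=0}=0$ satisfies the evolution equation if and only if $e^G=e^{s((u+v)L_1+M_1+uvt_1)}\,1$. -/

import Mathlib

open MvPowerSeries

noncomputable section

/-! ### Belyi graphs -/

/-- The three colours of the edges of a Belyi graph. -/
inductive EdgeColour : Type
  | red
  | green
  | blue

/-- The three colours, enumerated. -/
def EdgeColour.equivFin : Fin 3 ≃ EdgeColour where
  toFun i := match i with
    | 0 => .red
    | 1 => .green
    | 2 => .blue
  invFun c := match c with
    | .red => 0
    | .green => 1
    | .blue => 2
  left_inv i := by fin_cases i <;> rfl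
  right_inv c := by cases c <;> rfl

instance EdgeColour.instFinite : Finite EdgeColour := Finite.of_equiv _ EdgeColour.equivFin

theorem EdgeColour.card_eq : Nat.card EdgeColour = 3 := by
  rw [← Nat.card_congr EdgeColour.equivFin, Nat.card_fin]

/-- A Belyi graph with white vertices `W`, black vertices `B` and edges `E`: a connected bicoloured
3-valent graph (multiple edges are allowed) with properly 3-coloured edges.  Every edge joins a
white vertex to a black one, and every vertex is incident to exactly one edge of each of the three
colours.  The ribbon structure (cyclic order blue-green-red at the white vertices and
red-green-blue at the black ones) is determined by the colours and carries no further data. -/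
structure BelyiGraph (W B E : Type) where
  /-- the colour of an edge -/
  colour : E → EdgeColour
  /-- the white endpoint of an edge -/
  white : E → W
  /-- the black endpoint of an edge -/
  black : E → B
  white_proper : ∀ (w : W) (c : EdgeColour), ∃! e : E, white e = w ∧ colour e = c
  black_proper : ∀ (b : B) (c : EdgeColour), ∃! e : E, black e = b ∧ colour e = c
  /-- the underlying (nonempty) graph on all the vertices is connected -/
  connected : (SimpleGraph.fromRel (fun x y : W ⊕ B =>
    ∃ e : E, x = Sum.inl (white e) ∧ y = Sum.inr (black e))).Connected

namespace BelyiGraph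

variable {W B E W' B' E' W'' B'' E'' : Type}

/-- Isomorphisms of Belyi graphs: isomorphisms of graphs (bijections on vertices and on edges,
compatible with incidence) that respect the colours of vertices and edges. -/
structure Iso (Γ : BelyiGraph W B E) (Γ' : BelyiGraph W' B' E') where
  onWhite : W ≃ W'
  onBlack : B ≃ B'
  onEdge : E ≃ E'
  white_comm : ∀ e, Γ'.white (onEdge e) = onWhite (Γ.white e)
  black_comm : ∀ e, Γ'.black (onEdge e) = onBlack (Γ.black e)
  colour_comm : ∀ e, Γ'.colour (onEdge e) = Γ.colour e

namespace Iso

/-- The identity isomorphism. -/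
def refl (Γ : BelyiGraph W B E) : Iso Γ Γ where
  onWhite := Equiv.refl W
  onBlack := Equiv.refl B
  onEdge := Equiv.refl E
  white_comm _ := rfl
  black_comm _ := rfl
  colour_comm _ := rfl

/-- The inverse isomorphism. -/
def symm {Γ : BelyiGraph W B E} {Γ' : BelyiGraph W' B' E'} (f : Iso Γ Γ') : Iso Γ' Γ where
  onWhite := f.onWhite.symm
  onBlack := f.onBlack.symm
  onEdge := f.onEdge.symm
  white_comm e := by
    rw [Equiv.eq_symm_apply, ← f.white_comm, Equiv.apply_symm_apply]
  black_comm e := by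
    rw [Equiv.eq_symm_apply, ← f.black_comm, Equiv.apply_symm_apply]
  colour_comm e := by
    rw [← f.colour_comm, Equiv.apply_symm_apply]

/-- The composite isomorphism. -/
def trans {Γ : BelyiGraph W B E} {Γ' : BelyiGraph W' B' E'} {Γ'' : BelyiGraph W'' B'' E''}
    (f : Iso Γ Γ') (g : Iso Γ' Γ'') : Iso Γ Γ'' where
  onWhite := f.onWhite.trans g.onWhite
  onBlack := f.onBlack.trans g.onBlack
  onEdge := f.onEdge.trans g.onEdge
  white_comm e := by simp [g.white_comm, f.white_comm]
  black_comm e := by simp [g.black_comm, f.black_comm]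
  colour_comm e := by simp [g.colour_comm, f.colour_comm]

end Iso

theorem white_colour_bijective (Γ : BelyiGraph W B E) :
    Function.Bijective (fun e : E => (Γ.white e, Γ.colour e)) := by
  constructor
  · intro e e' h
    simp only [Prod.mk.injEq] at h
    exact (Γ.white_proper (Γ.white e') (Γ.colour e')).unique ⟨h.1, h.2⟩ ⟨rfl, rfl⟩
  · rintro ⟨w, c⟩
    obtain ⟨e, he, -⟩ := Γ.white_proper w c
    exact ⟨e, Prod.ext he.1 he.2⟩

theorem black_colour_bijective (Γ : BelyiGraph W B E) :
    Function.Bijective (fun e : E => (Γ.black e, Γ.colour e)) := by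
  constructor
  · intro e e' h
    simp only [Prod.mk.injEq] at h
    exact (Γ.black_proper (Γ.black e') (Γ.colour e')).unique ⟨h.1, h.2⟩ ⟨rfl, rfl⟩
  · rintro ⟨w, c⟩
    obtain ⟨e, he, -⟩ := Γ.black_proper w c
    exact ⟨e, Prod.ext he.1 he.2⟩

/-- Transport of a Belyi graph along bijections. -/
def map (Γ : BelyiGraph W B E) (f : W ≃ W') (g : B ≃ B') (h : E ≃ E') : BelyiGraph W' B' E' where
  colour e := Γ.colour (h.symm e)
  white e := f (Γ.white (h.symm e))
  black e := g (Γ.black (h.symm e))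
  white_proper w c := by
    obtain ⟨e, he, hu⟩ := Γ.white_proper (f.symm w) c
    refine ⟨h e, by simp [he.1, he.2], fun e' he' => ?_⟩
    rw [← hu (h.symm e') ⟨by rw [← he'.1, f.symm_apply_apply], he'.2⟩, h.apply_symm_apply]
  black_proper b c := by
    obtain ⟨e, he, hu⟩ := Γ.black_proper (g.symm b) c
    refine ⟨h e, by simp [he.1, he.2], fun e' he' => ?_⟩
    rw [← hu (h.symm e') ⟨by rw [← he'.1, g.symm_apply_apply], he'.2⟩, h.apply_symm_apply]
  connected := by
    refine Γ.connected.map (G := _) ⟨Equiv.sumCongr f g, ?_⟩ (Equiv.sumCongr f g).surjective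
    rintro x y hxy
    rw [SimpleGraph.fromRel_adj] at hxy ⊢
    refine ⟨fun hne => hxy.1 ((Equiv.sumCongr f g).injective hne), ?_⟩
    refine hxy.2.imp ?_ ?_ <;>
    · rintro ⟨e, rfl, rfl⟩
      exact ⟨h e, by simp, by simp⟩

/-- Every finite Belyi graph is isomorphic to one with `d` white vertices, `d` black vertices and
`3 * d` edges labelled by initial segments of the natural numbers. -/
theorem exists_model [Finite W] [Finite B] [Finite E] (Γ : BelyiGraph W B E) :
    ∃ (d : ℕ) (Γ' : BelyiGraph (Fin d) (Fin d) (Fin (3 * d))), Nonempty (Iso Γ Γ') := by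
  have hc : Nat.card EdgeColour = 3 := EdgeColour.card_eq
  have h1 := Nat.card_eq_of_bijective _ Γ.white_colour_bijective
  have h2 := Nat.card_eq_of_bijective _ Γ.black_colour_bijective
  rw [Nat.card_prod, hc] at h1 h2
  have e1 : W ≃ Fin (Nat.card W) := Finite.equivFin W
  have e2 : B ≃ Fin (Nat.card W) := Finite.equivFinOfCardEq (by omega)
  have e3 : E ≃ Fin (3 * Nat.card W) := Finite.equivFinOfCardEq (by omega)
  exact ⟨_, Γ.map e1 e2 e3, ⟨⟨e1, e2, e3, by simp [map], by simp [map], by simp [map]⟩⟩⟩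

/-- The automorphism group of a Belyi graph (as a type). -/
abbrev Aut (Γ : BelyiGraph W B E) : Type := Iso Γ Γ

/-- The subgraph formed by all the vertices and the edges of colours `a` and `b`. -/
def bicolouredGraph (Γ : BelyiGraph W B E) (a b : EdgeColour) : SimpleGraph (W ⊕ B) :=
  SimpleGraph.fromRel (fun x y : W ⊕ B => ∃ e : E, (Γ.colour e = a ∨ Γ.colour e = b) ∧
    x = Sum.inl (Γ.white e) ∧ y = Sum.inr (Γ.black e))

/-- The `a`-`b` cycles of a Belyi graph: the connected components of the subgraph of the edges of
the colours `a ≠ b` (each is a cycle with edges of alternating colours, since every vertex is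
incident to exactly one edge of each colour). -/
abbrev Cycle (Γ : BelyiGraph W B E) (a b : EdgeColour) : Type :=
  (Γ.bicolouredGraph a b).ConnectedComponent

/-- The length of an `a`-`b` cycle: the number of its edges. -/
def Cycle.length {Γ : BelyiGraph W B E} {a b : EdgeColour} (C : Γ.Cycle a b) : ℕ :=
  {e : E | (Γ.colour e = a ∨ Γ.colour e = b) ∧
    (Γ.bicolouredGraph a b).connectedComponentMk (Sum.inl (Γ.white e)) = C}.ncard

/-- `Γ` is of type `(k, l; m₁, m₂, …)`: it has `k` red-green cycles, `l` green-blue cycles and, for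
every `i ≥ 1`, `mᵢ` red-blue cycles of length `2i`. -/
def HasType (Γ : BelyiGraph W B E) (k l : ℕ) (m : ℕ+ → ℕ) : Prop :=
  Nat.card (Γ.Cycle .red .green) = k ∧
  Nat.card (Γ.Cycle .green .blue) = l ∧
  ∀ i : ℕ+, Nat.card {C : Γ.Cycle .red .blue // C.length = 2 * (i : ℕ)} = m i

/-- Isomorphism of Belyi graphs of degree `d` as an equivalence relation. -/
instance isoSetoid (W B E : Type) : Setoid (BelyiGraph W B E) where
  r Γ Γ' := Nonempty (Iso Γ Γ')
  iseqv :=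
    { refl := fun Γ => ⟨Iso.refl Γ⟩
      symm := fun ⟨f⟩ => ⟨f.symm⟩
      trans := fun ⟨f⟩ ⟨g⟩ => ⟨f.trans g⟩ }

end BelyiGraph

/-- The isomorphism classes of Belyi graphs of degree `d`.  The degree is the number of white
vertices, which is also the number of black vertices and the number of edges of each colour, so
that all graphs of degree `d` occur, up to isomorphism, on these sets of vertices and edges. -/
abbrev BelyiClass (d : ℕ) : Type :=
  Quotient (BelyiGraph.isoSetoid (Fin d) (Fin d) (Fin (3 * d)))

instance BelyiGraph.instFinite (W B E : Type) [Finite W] [Finite B] [Finite E] :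
    Finite (BelyiGraph W B E) :=
  Finite.of_injective
    (fun Γ : BelyiGraph W B E => (Γ.colour, Γ.white, Γ.black))
    (by
      rintro ⟨c, w, b, _, _, _⟩ ⟨c', w', b', _, _, _⟩ h
      simp only [Prod.mk.injEq] at h
      obtain ⟨rfl, rfl, rfl⟩ := h
      rfl)

/-- The finite set of isomorphism classes of Belyi graphs of degree `d` and type `(k, l; m)`. -/
def belyiClassesOfType (d k l : ℕ) (m : ℕ+ → ℕ) : Set (BelyiClass d) :=
  {c | c.out.HasType k l m}

/-- The weighted count `∑ 1 / |Aut Γ|` over the isomorphism classes of Belyi graphs `Γ` of degree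
`d` and type `(k, l; m)`. -/
def weightedCount (d k l : ℕ) (m : ℕ+ → ℕ) : ℚ :=
  ∑ᶠ c ∈ belyiClassesOfType d k l m, 1 / (Nat.card c.out.Aut : ℚ)

/-! ### Formal power series in `s, u, v, t₁, t₂, …` -/

/-- The variables `s, u, v, t₁, t₂, …`. -/
inductive Var : Type
  | s
  | u
  | v
  | t (i : ℕ+)

/-- Formal power series in `s, u, v, t₁, t₂, …` with rational coefficients. -/
abbrev Ser : Type := MvPowerSeries Var ℚ

namespace Ser

/-- The variable `s`. -/
abbrev s : Ser := X Var.s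
/-- The variable `u`. -/
abbrev u : Ser := X Var.u
/-- The variable `v`. -/
abbrev v : Ser := X Var.v
/-- The variable `tᵢ`. -/
abbrev t (i : ℕ+) : Ser := X (Var.t i)
/-- The partial derivative `∂F/∂s`. -/
abbrev ds (F : Ser) : Ser := pderiv ℚ Var.s F
/-- The partial derivative `∂F/∂tᵢ`. -/
abbrev dt (i : ℕ+) (F : Ser) : Ser := pderiv ℚ (Var.t i) F

/-- A family of power series is summable if every monomial occurs in only finitely many members. -/
def Summable {ι : Type} (f : ι → Ser) : Prop :=
  ∀ n : Var →₀ ℕ, {i | coeff n (f i) ≠ 0}.Finite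

/-- The sum of a summable family of power series, coefficient by coefficient. -/
def sum {ι : Type} (f : ι → Ser) : Ser := fun n => ∑ᶠ i, coeff n (f i)

/-- The restriction `F|_{s=0}`. -/
def atZero (F : Ser) : Ser :=
  open Classical in fun n => if n Var.s = 0 then coeff n F else 0

/-- The `i`-th term (`i ≥ 2`) of `L₁ F`. -/
def termL (F : Ser) (i : {i : ℕ+ // 2 ≤ i}) : Ser :=
  ((i.1 : ℚ) - 1) • (t i * dt (i - 1) F)

/-- The `i`-th term (`i ≥ 2`) of `M₁ F`. -/
def termM (F : Ser) (i : {i : ℕ+ // 2 ≤ i}) : Ser :=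
  ∑ j ∈ Finset.Ico 1 i.1,
    (((i.1 : ℚ) - 1) • (t j * t (i - j) * dt (i - 1) F) +
      ((j : ℚ) * ((i.1 : ℚ) - (j : ℚ))) • (t (i + 1) * dt j (dt (i - j) F)))

/-- The `i`-th term (`i ≥ 2`) of `Q₁ F`. -/
def termQ (F : Ser) (i : {i : ℕ+ // 2 ≤ i}) : Ser :=
  ∑ j ∈ Finset.Ico 1 i.1,
    ((j : ℚ) * ((i.1 : ℚ) - (j : ℚ))) • (t (i + 1) * (dt j F * dt (i - j) F))

/-- `L₁ F = ∑_{i ≥ 2} (i-1) tᵢ ∂F/∂tᵢ₋₁`. -/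
def L (F : Ser) : Ser := sum (termL F)

/-- `M₁ F = ∑_{i ≥ 2} ∑_{1 ≤ j ≤ i-1} (i-1) tⱼ tᵢ₋ⱼ ∂F/∂tᵢ₋₁ + j(i-j) tᵢ₊₁ ∂²F/∂tⱼ∂tᵢ₋ⱼ`. -/
def M (F : Ser) : Ser := sum (termM F)

/-- `Q₁ F = ∑_{i ≥ 2} ∑_{1 ≤ j ≤ i-1} j(i-j) tᵢ₊₁ (∂F/∂tⱼ)(∂F/∂tᵢ₋ⱼ)`. -/
def Q (F : Ser) : Ser := sum (termQ F)

/-- The evolution equation `∂F/∂s = ((u+v)L₁ + M₁ + Q₁)F + u v t₁`. -/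
def EvolutionEquation (F : Ser) : Prop :=
  ds F = (u + v) * L F + M F + Q F + u * v * t 1

/-- The linear operator `s((u+v)L₁ + M₁ + u v t₁)`, the last summand acting by multiplication. -/
def generator (G : Ser) : Ser := s * ((u + v) * L G + M G + u * v * t 1 * G)

/-- The exponential `e^P G = ∑ₙ Pⁿ G / n!` of an operator `P` applied to `G`. -/
def opExp (P : Ser → Ser) (G : Ser) : Ser :=
  sum (fun n : ℕ => ((n.factorial : ℚ)⁻¹) • (P^[n] G))

/-- The exponential `e^F` of a power series without constant term. -/
def exp (F : Ser) : Ser := (PowerSeries.exp ℚ).subst F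

/-! The sums above are sums of summable families. -/

theorem finite_setOf_t_mem (n : Var →₀ ℕ) : {i : ℕ+ | n (Var.t i) ≠ 0}.Finite := by
  have h : {i : ℕ+ | n (Var.t i) ≠ 0} = Var.t ⁻¹' (n.support : Set Var) := by
    ext i
    simp
  rw [h]
  exact n.support.finite_toSet.preimage (fun a _ b _ hab => by injection hab)

theorem coeff_t_mul_eq_zero {n : Var →₀ ℕ} {i : ℕ+} (h : n (Var.t i) = 0) (G : Ser) :
    coeff n (t i * G) = 0 := by
  classical
  rw [Ser.t, X_def, coeff_monomial_mul, if_neg]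
  intro hle
  have := hle (Var.t i)
  simp [h] at this

theorem summable_termL (F : Ser) : Summable (termL F) := by
  intro n
  refine ((finite_setOf_t_mem n).preimage (f := fun i : {i : ℕ+ // 2 ≤ i} => i.1)
    Subtype.val_injective.injOn).subset ?_
  intro i hi
  simp only [Set.mem_preimage, Set.mem_ofPred_eq] at hi ⊢
  intro h0
  exact hi (by rw [termL, map_smul, coeff_t_mul_eq_zero h0, smul_zero])

theorem summable_termQ (F : Ser) : Summable (termQ F) := by
  intro n
  refine ((finite_setOf_t_mem n).preimage (f := fun i : {i : ℕ+ // 2 ≤ i} => i.1 + 1)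
    (fun a _ b _ hab => Subtype.ext (by simpa using hab))).subset ?_
  intro i hi
  simp only [Set.mem_preimage, Set.mem_ofPred_eq] at hi ⊢
  intro h0
  refine hi ?_
  rw [termQ, map_sum]
  refine Finset.sum_eq_zero fun j _ => ?_
  rw [map_smul, coeff_t_mul_eq_zero h0, smul_zero]

theorem summable_termM (F : Ser) : Summable (termM F) := by
  intro n
  have h1 := (finite_setOf_t_mem n).preimage (f := fun i : {i : ℕ+ // 2 ≤ i} => i.1 + 1)
    (fun a _ b _ hab => Subtype.ext (by simpa using hab))
  have h2 := (((finite_setOf_t_mem n).prod (finite_setOf_t_mem n)).image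
    (fun p : ℕ+ × ℕ+ => p.1 + p.2)).preimage (f := fun i : {i : ℕ+ // 2 ≤ i} => i.1)
    Subtype.val_injective.injOn
  refine (h1.union h2).subset ?_
  intro i hi
  by_contra hcon
  simp only [Set.mem_union, Set.mem_preimage, Set.mem_ofPred_eq, not_or, not_not, Set.mem_image,
    Set.mem_prod, not_exists, not_and, Prod.forall] at hcon
  refine hi ?_
  rw [termM, map_sum]
  refine Finset.sum_eq_zero fun j hj => ?_
  rw [Finset.mem_Ico] at hj
  have hsum : j + (i.1 - j) = i.1 := PNat.add_sub_of_lt hj.2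
  rw [map_add, map_smul, map_smul, coeff_t_mul_eq_zero hcon.1, smul_zero, add_zero]
  by_cases hjn : n (Var.t j) = 0
  · rw [mul_assoc, coeff_t_mul_eq_zero hjn, smul_zero]
  · have hk : n (Var.t (i.1 - j)) = 0 := by
      by_contra hk
      exact hcon.2 _ _ ⟨hjn, hk⟩ hsum
    rw [mul_comm (t j), mul_assoc, coeff_t_mul_eq_zero hk, smul_zero]

/-- `F` is divisible by `s ^ k`. -/
def OrderGE (k : ℕ) (F : Ser) : Prop := ∀ n : Var →₀ ℕ, n Var.s < k → coeff n F = 0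

theorem OrderGE.mul_left {k : ℕ} {F : Ser} (hF : OrderGE k F) (G : Ser) : OrderGE k (G * F) := by
  classical
  intro n hn
  rw [coeff_mul]
  refine Finset.sum_eq_zero fun p hp => ?_
  rw [Finset.HasAntidiagonal.mem_antidiagonal] at hp
  rw [hF p.2 (lt_of_le_of_lt _ hn), mul_zero]
  rw [← hp]
  simp

theorem OrderGE.smul {k : ℕ} {F : Ser} (hF : OrderGE k F) (c : ℚ) : OrderGE k (c • F) := by
  intro n hn
  rw [map_smul, hF n hn, smul_zero]

theorem OrderGE.add {k : ℕ} {F G : Ser} (hF : OrderGE k F) (hG : OrderGE k G) :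
    OrderGE k (F + G) := by
  intro n hn
  rw [map_add, hF n hn, hG n hn, add_zero]

theorem OrderGE.finset_sum {k : ℕ} {ι : Type} {S : Finset ι} {f : ι → Ser}
    (hf : ∀ i ∈ S, OrderGE k (f i)) : OrderGE k (∑ i ∈ S, f i) := by
  intro n hn
  rw [map_sum]
  exact Finset.sum_eq_zero fun i hi => hf i hi n hn

theorem OrderGE.sum {k : ℕ} {ι : Type} {f : ι → Ser} (hf : ∀ i, OrderGE k (f i)) :
    OrderGE k (Ser.sum f) := by
  intro n hn
  change ∑ᶠ i, coeff n (f i) = 0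
  simp [hf _ n hn]

theorem OrderGE.dt {k : ℕ} {F : Ser} (hF : OrderGE k F) (i : ℕ+) : OrderGE k (dt i F) := by
  classical
  intro n hn
  rw [Ser.dt, coeff_pderiv, hF, zero_mul]
  simpa using hn

theorem OrderGE.generator {k : ℕ} {F : Ser} (hF : OrderGE k F) :
    OrderGE (k + 1) (generator F) := by
  classical
  have h : OrderGE k ((u + v) * L F + M F + u * v * t 1 * F) := by
    refine ((OrderGE.mul_left ?_ _).add ?_).add (hF.mul_left _)
    · exact OrderGE.sum fun i => ((hF.dt _).mul_left _).smul _
    · exact OrderGE.sum fun i => OrderGE.finset_sum fun j _ =>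
        (((hF.dt _).mul_left _).smul _).add ((((hF.dt _).dt _).mul_left _).smul _)
  intro n hn
  rw [Ser.generator, Ser.s, X_def, coeff_monomial_mul]
  split_ifs with hle
  · rw [h, mul_zero]
    have := hle Var.s
    simp only [Finsupp.single_eq_same] at this
    simp only [Finsupp.tsub_apply, Finsupp.single_eq_same]
    omega
  · rfl

theorem summable_opExp_generator (G : Ser) :
    Summable (fun n : ℕ => ((n.factorial : ℚ)⁻¹) • (generator^[n] G)) := by
  have h : ∀ n : ℕ, OrderGE n (generator^[n] G) := by
    intro n
    induction n with
    | zero => intro m hm; omega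
    | succ n ih =>
      rw [Function.iterate_succ_apply']
      exact ih.generator
  intro m
  refine (Set.finite_Iic (m Var.s)).subset ?_
  intro n hn
  by_contra hlt
  rw [Set.mem_Iic, not_le] at hlt
  exact hn (((h n).smul _) m hlt)

end Ser

/-- The total generating function `F(s, u, v, t₁, t₂, …)`: the coefficient of
`s^d u^k v^l t₁^m₁ t₂^m₂ ⋯` is the weighted count of the Belyi graphs of degree `d` and type
`(k, l; m₁, m₂, …)`. (Such graphs exist only if `d, k, l ≥ 1` and `∑ i mᵢ = d`.) -/
def totalGF : Ser := fun n =>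
  weightedCount (n Var.s) (n Var.u) (n Var.v) (fun i => n (Var.t i))

theorem totalGF_hasSubst : PowerSeries.HasSubst totalGF := by
  apply PowerSeries.HasSubst.of_constantCoeff_zero
  rw [← coeff_zero_eq_constantCoeff_apply]
  change weightedCount 0 _ _ _ = 0
  have : IsEmpty (BelyiClass 0) := by
    refine ⟨fun c => ?_⟩
    obtain ⟨x⟩ := c.out.connected.nonempty
    rcases x with x | x <;> exact x.elim0
  exact finsum_of_isEmpty _

end

/-!
The partition function `Z = e^F` counts pairs of permutations that need not be transitive, and the
evolution equation is the logarithmic form of a linear recursion for these pairs.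

*Belyi graphs and permutations.* Following the red edge from a white vertex and going back along the
green edge is a permutation `α` of the white vertices; blue and green edges give a permutation `β`.
The cycles of `α`, of `β` and, up to conjugation, of `α β⁻¹` are the red-green, green-blue and
red-blue cycles of the graph; connectedness means transitivity of the pair, and isomorphism means
simultaneous conjugacy. By orbit-stabiliser, the coefficient of `F` in `s`-degree `d` is `1 / d!`
times the number of transitive pairs of permutations of `d` points of the given type
(`coeff_totalGF`).

*Exponential formula.* A pair of permutations of a pointed set is a transitive pair on the orbit of
the point together with an arbitrary pair on the complement (`pairSum_fin_succ`). This recursion is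
the equation `s ∂Z/∂s = Z · s ∂F/∂s` for the generating function `Z` of all pairs, whence `Z = e^F`
(`Ser.exp_eq_opExp_of_convolution`).

*Cut and join.* Every pair of permutations of `d + 1` points arises uniquely from a pair
`(α, β)` of permutations of `d` points as `((p i) α, (p j) β)`, where `p` is the new point, and
`i`, `j` are arbitrary points. For `i = j = p` a fixed point of the product is created, which is the
operator `u v t₁`; if only one of `i`, `j` is `p`, then `p` is inserted into a cycle of the product,
which is the operator `(u + v)L₁`; otherwise a cycle in which `p` has been inserted is moreover cut
into two or joined with another one, which is the operator `M₁`. So the sum over the pairs of `d`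
points is the `d`-th iterate of the operator `s((u + v)L₁ + M₁ + u v t₁)` applied to `1`
(`pairSum_fin`), and `Z` is the operator exponential.

*Linearisation.* Since `M₁ e^G = e^G (M₁ + Q₁) G`, the evolution equation for `G` is the linear
equation `∂Z/∂s = ((u + v)L₁ + M₁ + u v t₁) Z` for `Z = e^G`, which is solved degree by degree in
`s` and has a unique solution with `Z = 1` at `s = 0` (`Ser.evolutionEquation_iff`).
-/

noncomputable section

/-! ### Sums of summable families of power series -/

namespace Ser

theorem coeff_sum {ι : Type} (f : ι → Ser) (n : Var →₀ ℕ) :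
    coeff n (sum f) = ∑ᶠ i, coeff n (f i) := rfl

theorem Summable.hasFiniteSupport {ι : Type} {f : ι → Ser} (hf : Summable f) (n : Var →₀ ℕ) :
    Function.HasFiniteSupport (fun i => coeff n (f i)) := hf n

theorem Summable.finset_sum {ι κ : Type} {A : Finset κ} {f : κ → ι → Ser}
    (hf : ∀ a ∈ A, Summable (f a)) : Summable (fun i => ∑ a ∈ A, f a i) := by
  intro n
  refine (A.finite_toSet.biUnion fun a ha => hf a ha n).subset ?_
  intro i hi
  by_contra hcon
  refine hi ?_
  rw [map_sum]
  refine Finset.sum_eq_zero fun a ha => ?_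
  by_contra h
  exact hcon (Set.mem_biUnion (show a ∈ (A : Set κ) from ha) h)

theorem sum_add {ι : Type} {f g : ι → Ser} (hf : Summable f) (hg : Summable g) :
    sum (fun i => f i + g i) = sum f + sum g := by
  ext n
  rw [map_add, coeff_sum, coeff_sum, coeff_sum,
    ← finsum_add_distrib (hf.hasFiniteSupport n) (hg.hasFiniteSupport n)]
  simp

theorem sum_smul {ι : Type} (f : ι → Ser) (c : ℚ) : sum (fun i => c • f i) = c • sum f := by
  ext n
  simp only [map_smul, coeff_sum, smul_eq_mul, mul_finsum]

theorem sum_finset_sum {ι κ : Type} {A : Finset κ} {f : κ → ι → Ser}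
    (hf : ∀ a ∈ A, Summable (f a)) : sum (fun i => ∑ a ∈ A, f a i) = ∑ a ∈ A, sum (f a) := by
  ext n
  simp only [map_sum, coeff_sum]
  exact finsum_sum_comm A _ fun a ha => (hf a ha).hasFiniteSupport n

theorem Summable.mul_left {ι : Type} {f : ι → Ser} (hf : Summable f) (e : Ser) :
    Summable (fun i => e * f i) := by
  classical
  intro n
  refine ((Finset.HasAntidiagonal.antidiagonal n).finite_toSet.biUnion
    fun p _ => hf p.2).subset fun i hi => ?_
  by_contra hcon
  refine hi ?_
  rw [coeff_mul]
  refine Finset.sum_eq_zero fun p hp => ?_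
  by_contra h0
  exact hcon (Set.mem_biUnion (Finset.mem_coe.2 hp) (right_ne_zero_of_mul h0))

theorem sum_mul_left {ι : Type} {f : ι → Ser} (hf : Summable f) (e : Ser) :
    sum (fun i => e * f i) = e * sum f := by
  classical
  ext n
  simp only [coeff_sum, coeff_mul, mul_finsum]
  refine finsum_sum_comm _ _ fun p _ => (hf p.2).subset fun i hi => ?_
  exact right_ne_zero_of_mul hi

theorem sum_eq_single {ι : Type} (f : ι → Ser) (a : ι) (h : ∀ i, i ≠ a → f i = 0) :
    sum f = f a := by
  ext n
  rw [coeff_sum]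
  exact finsum_eq_single _ a fun i hi => by rw [h i hi, map_zero]

/-! ### The operators on sums and on exponentials -/

theorem termL_add (F G : Ser) (i) : termL (F + G) i = termL F i + termL G i := by
  simp only [termL, map_add, mul_add, smul_add]

theorem termM_add (F G : Ser) (i) : termM (F + G) i = termM F i + termM G i := by
  simp only [termM, map_add, mul_add, smul_add, ← Finset.sum_add_distrib]
  exact Finset.sum_congr rfl fun j _ => by abel

theorem L_add (F G : Ser) : L (F + G) = L F + L G := by
  simp only [L]
  rw [← sum_add (summable_termL F) (summable_termL G)]
  exact congrArg sum (funext fun i => termL_add F G i)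

theorem M_add (F G : Ser) : M (F + G) = M F + M G := by
  simp only [M]
  rw [← sum_add (summable_termM F) (summable_termM G)]
  exact congrArg sum (funext fun i => termM_add F G i)

theorem dt_smul (i : ℕ+) (c : ℚ) (F : Ser) : dt i (c • F) = c • dt i F :=
  Derivation.map_smul _ c F

theorem L_smul (c : ℚ) (F : Ser) : L (c • F) = c • L F := by
  simp only [L]
  rw [← sum_smul]
  refine congrArg sum (funext fun i => ?_)
  rw [termL, termL, dt_smul, mul_smul_comm, smul_comm]

theorem M_smul (c : ℚ) (F : Ser) : M (c • F) = c • M F := by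
  simp only [M]
  rw [← sum_smul]
  refine congrArg sum (funext fun i => ?_)
  simp only [termM, dt_smul, mul_smul_comm, Finset.smul_sum, smul_add]
  exact Finset.sum_congr rfl fun j _ => by
    rw [smul_comm c, smul_comm c]

theorem generator_add (F G : Ser) : generator (F + G) = generator F + generator G := by
  simp only [generator, L_add, M_add]
  ring

theorem generator_smul (c : ℚ) (F : Ser) : generator (c • F) = c • generator F := by
  simp only [generator, L_smul, M_smul, mul_smul_comm, ← smul_add]

theorem generator_zero : generator 0 = 0 := by
  have := generator_smul 0 0
  simpa using this

theorem generator_sub (F G : Ser) : generator (F - G) = generator F - generator G := by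
  have := generator_add (F - G) G
  rw [sub_add_cancel] at this
  rw [this, add_sub_cancel_right]

theorem generator_sum {ι : Type} (A : Finset ι) (f : ι → Ser) :
    generator (∑ a ∈ A, f a) = ∑ a ∈ A, generator (f a) := by
  classical
  induction A using Finset.induction_on with
  | empty => simp [generator_zero]
  | insert a A ha ih => rw [Finset.sum_insert ha, Finset.sum_insert ha, generator_add, ih]

/-- If `e` is an exponential of `G` as far as the `tᵢ`-derivatives are concerned, the second order
operator `M₁` applied to `e` produces the quadratic operator `Q₁` applied to `G`. -/
theorem generator_of_dt_eq {e G : Ser} (h : ∀ i, dt i e = e * dt i G) :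
    generator e = e * (s * ((u + v) * L G + M G + Q G + u * v * t 1)) := by
  have hL : L e = e * L G := by
    simp only [L]
    rw [← sum_mul_left (summable_termL G)]
    refine congrArg sum (funext fun i => ?_)
    rw [termL, termL, h, mul_smul_comm, mul_left_comm]
  have hM : M e = e * (M G + Q G) := by
    simp only [M, Q]
    rw [mul_add, ← sum_mul_left (summable_termM G), ← sum_mul_left (summable_termQ G),
      ← sum_add]
    · refine congrArg sum (funext fun i => ?_)
      simp only [termM, termQ, Finset.mul_sum, ← Finset.sum_add_distrib]
      refine Finset.sum_congr rfl fun j _ => ?_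
      have h2 : dt j (dt (i.1 - j) e) =
          e * (dt j (dt (i.1 - j) G) + dt j G * dt (i.1 - j) G) := by
        rw [h, dt, Derivation.leibniz, smul_eq_mul, smul_eq_mul, ← dt, ← dt, h]
        ring
      rw [h2, h]
      simp only [mul_smul_comm, mul_add, smul_add]
      have e1 : t j * t (i.1 - j) * (e * dt (i.1 - 1) G) =
          e * (t j * t (i.1 - j) * dt (i.1 - 1) G) := by ring
      have e2 : t (i.1 + 1) * (e * dt j (dt (i.1 - j) G)) =
          e * (t (i.1 + 1) * dt j (dt (i.1 - j) G)) := by ring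
      have e3 : t (i.1 + 1) * (e * (dt j G * dt (i.1 - j) G)) =
          e * (t (i.1 + 1) * (dt j G * dt (i.1 - j) G)) := by ring
      rw [e1, e2, e3, add_assoc]
    · exact (summable_termM G).mul_left e
    · exact (summable_termQ G).mul_left e
  rw [generator, hL, hM]
  ring

/-! ### The order in `s` and the Euler operator `s ∂/∂s` -/

theorem orderGE_zero (F : Ser) : OrderGE 0 F := fun _ hn => absurd hn (Nat.not_lt_zero _)

theorem OrderGE.mul {k l : ℕ} {F G : Ser} (hF : OrderGE k F) (hG : OrderGE l G) :
    OrderGE (k + l) (F * G) := by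
  classical
  intro n hn
  rw [coeff_mul]
  refine Finset.sum_eq_zero fun p hp => ?_
  rw [Finset.HasAntidiagonal.mem_antidiagonal] at hp
  have hs : p.1 Var.s + p.2 Var.s = n Var.s := by rw [← hp]; rfl
  rcases lt_or_ge (p.1 Var.s) k with h | h
  · rw [hF _ h, zero_mul]
  · rw [hG _ (by omega), mul_zero]

theorem OrderGE.pow {F : Ser} (hF : OrderGE 1 F) (k : ℕ) : OrderGE k (F ^ k) := by
  induction k with
  | zero => exact orderGE_zero _
  | succ k ih => rw [pow_succ]; exact ih.mul hF

theorem eq_zero_of_orderGE {F : Ser} (h : ∀ k, OrderGE k F → OrderGE (k + 1) F) : F = 0 := by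
  have h' : ∀ k, OrderGE k F := fun k => by
    induction k with
    | zero => exact orderGE_zero F
    | succ k ih => exact h k ih
  ext n
  rw [h' (n Var.s + 1) n (Nat.lt_succ_self _), map_zero]

theorem orderGE_one_iff {F : Ser} : OrderGE 1 F ↔ atZero F = 0 := by
  constructor
  · intro h
    ext n
    change (if n Var.s = 0 then coeff n F else 0) = 0
    split_ifs with h0
    · exact h n (by omega)
    · rfl
  · intro h n hn
    have h1 : (if n Var.s = 0 then coeff n F else 0) = 0 := congrFun h n
    rwa [if_pos (by omega)] at h1

theorem coeff_s_mul_ds (F : Ser) (n : Var →₀ ℕ) :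
    coeff n (s * ds F) = (n Var.s : ℚ) * coeff n F := by
  classical
  rw [s, X_def, coeff_monomial_mul]
  split_ifs with h
  · have h1 : 1 ≤ n Var.s := by simpa using h Var.s
    rw [one_mul, ds, coeff_pderiv, tsub_add_cancel_of_le h, mul_comm]
    congr 1
    simp only [Finsupp.tsub_apply, Finsupp.single_eq_same]
    exact_mod_cast Nat.sub_add_cancel h1
  · have h1 : n Var.s = 0 := by
      by_contra h0
      refine h (Finsupp.single_le_iff.2 (by omega))
    rw [h1, Nat.cast_zero, zero_mul]

theorem s_mul_cancel {F G : Ser} (h : s * F = s * G) : F = G :=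
  mul_left_cancel₀ (show s ≠ 0 from fun h0 => by
    classical
    have h1 := congrArg (coeff (Finsupp.single Var.s 1)) h0
    rw [s, X_def, coeff_monomial_same, map_zero] at h1
    exact one_ne_zero h1) h

/-- If `s ∂E/∂s` has greater order in `s` than `E`, as happens for a solution of a linear equation
`s ∂E/∂s = P(E)` with an operator `P` raising the order, and `E` vanishes at `s = 0`, then
`E = 0`. -/
theorem eq_zero_of_euler {E R : Ser} (h0 : OrderGE 1 E) (h : s * ds E = R)
    (hR : ∀ k, OrderGE k E → OrderGE (k + 1) R) : E = 0 := by
  refine eq_zero_of_orderGE fun k hk => ?_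
  intro n hn
  rcases Nat.eq_zero_or_pos (n Var.s) with hz | hz
  · exact h0 n (by omega)
  · have h1 : (n Var.s : ℚ) * coeff n E = 0 := by
      rw [← coeff_s_mul_ds, h, hR k hk n hn]
    exact (mul_eq_zero.1 h1).resolve_left (by exact_mod_cast hz.ne')

/-! ### The exponential of a power series divisible by `s` -/

theorem hasSubst_of_orderGE {F : Ser} (hF : OrderGE 1 F) : PowerSeries.HasSubst F := by
  apply PowerSeries.HasSubst.of_constantCoeff_zero
  rw [← coeff_zero_eq_constantCoeff_apply]
  exact hF 0 (by simp)

theorem coeff_exp {F : Ser} (hF : OrderGE 1 F) (n : Var →₀ ℕ) {N : ℕ} (hN : n Var.s < N) :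
    coeff n (exp F) = coeff n (∑ k ∈ Finset.range N, ((k.factorial : ℚ)⁻¹) • F ^ k) := by
  rw [exp, PowerSeries.coeff_subst (hasSubst_of_orderGE hF), map_sum]
  rw [finsum_eq_sum_of_support_subset (s := Finset.range N)]
  · refine Finset.sum_congr rfl fun k _ => ?_
    rw [PowerSeries.coeff_exp, map_smul]
    simp
  · intro k hk
    by_contra hcon
    refine hk ?_
    rw [Finset.coe_range, Set.mem_Iio, not_lt] at hcon
    simp only
    rw [hF.pow k n (by omega), smul_zero]

/-- The chain rule for `e^F`. -/
theorem pderiv_exp {F : Ser} (hF : OrderGE 1 F) (x : Var) :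
    pderiv ℚ x (exp F) = exp F * pderiv ℚ x F := by
  classical
  ext n
  set N := n Var.s + 2 with hN
  have hx : ∀ y : Var, (Finsupp.single x 1 : Var →₀ ℕ) y ≤ 1 := fun y => by
    rw [Finsupp.single_apply]; split_ifs <;> omega
  have h1 : (n + Finsupp.single x 1 : Var →₀ ℕ) Var.s < N := by
    have := hx Var.s
    rw [Finsupp.add_apply]; omega
  rw [coeff_pderiv, coeff_exp hF _ h1, ← coeff_pderiv, map_sum, hN, Finset.sum_range_succ']
  have h2 : ∀ k, pderiv ℚ x (((k + 1).factorial : ℚ)⁻¹ • F ^ (k + 1)) =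
      ((k.factorial : ℚ)⁻¹ • F ^ k) * pderiv ℚ x F := by
    intro k
    rw [Derivation.map_smul, Derivation.leibniz_pow, Nat.add_sub_cancel, smul_eq_mul, ← Nat.cast_smul_eq_nsmul ℚ,
      smul_smul, smul_mul_assoc]
    congr 1
    rw [Nat.factorial_succ]
    push_cast
    have : (k.factorial : ℚ) ≠ 0 := by exact_mod_cast k.factorial_ne_zero
    field_simp
  rw [Finset.sum_congr rfl fun k _ => h2 k, ← Finset.sum_mul]
  have h3 : pderiv ℚ x ((((0 : ℕ).factorial : ℚ)⁻¹) • F ^ 0) = 0 := by simp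
  rw [h3, add_zero, coeff_mul, coeff_mul]
  refine Finset.sum_congr rfl fun p hp => ?_
  rw [Finset.HasAntidiagonal.mem_antidiagonal] at hp
  rw [coeff_exp hF p.1 (N := n Var.s + 1)]
  rw [← hp, Finsupp.add_apply]
  omega

theorem orderGE_exp_sub_one {F : Ser} (hF : OrderGE 1 F) : OrderGE 1 (exp F - 1) := by
  intro n hn
  rw [map_sub, coeff_exp hF n hn]
  simp

theorem exp_ne_zero {F : Ser} (hF : OrderGE 1 F) : exp F ≠ 0 := by
  classical
  intro h
  have h1 := orderGE_exp_sub_one hF 0 (by simp)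
  rw [h, map_sub, map_zero, coeff_zero_one] at h1
  norm_num at h1

theorem exp_injective {F G : Ser} (hF : OrderGE 1 F) (hG : OrderGE 1 G) (h : exp F = exp G) :
    F = G := by
  have h1 : exp F * ds F = exp F * ds G := by
    rw [← pderiv_exp hF, h, ← pderiv_exp hG]
  have h2 : ds F = ds G := mul_left_cancel₀ (exp_ne_zero hF) h1
  ext n
  rcases Nat.eq_zero_or_pos (n Var.s) with hz | hz
  · rw [hF n (by omega), hG n (by omega)]
  · have h3 := congrArg (coeff n) (congrArg (s * ·) h2)
    simp only [coeff_s_mul_ds] at h3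
    exact mul_left_cancel₀ (by exact_mod_cast hz.ne') h3

/-! ### The evolution equation and the exponential formula for the partition function -/

theorem orderGE_iterate_generator (G : Ser) (n : ℕ) : OrderGE n (generator^[n] G) := by
  induction n with
  | zero => exact orderGE_zero _
  | succ n ih =>
    rw [Function.iterate_succ_apply']
    exact ih.generator

theorem coeff_opExp_generator (G : Ser) (n : Var →₀ ℕ) {N : ℕ} (hN : n Var.s < N) :
    coeff n (opExp generator G) =
      coeff n (∑ k ∈ Finset.range N, ((k.factorial : ℚ)⁻¹) • (generator^[k] G)) := by
  rw [opExp, coeff_sum, map_sum]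
  refine finsum_eq_sum_of_support_subset _ fun k hk => ?_
  by_contra hcon
  rw [Finset.coe_range, Set.mem_Iio, not_lt] at hcon
  exact hk (((orderGE_iterate_generator G k).smul _) n (by omega))

/-- `F` is homogeneous of degree `d` in `s`. -/
def SHom (d : ℕ) (F : Ser) : Prop := ∀ n : Var →₀ ℕ, n Var.s ≠ d → coeff n F = 0

theorem SHom.sum {d : ℕ} {ι : Type} {f : ι → Ser} (h : ∀ i, SHom d (f i)) : SHom d (Ser.sum f) := by
  intro n hn
  rw [coeff_sum]
  simp [h _ n hn]

theorem SHom.finset_sum {d : ℕ} {ι : Type} {A : Finset ι} {f : ι → Ser}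
    (h : ∀ i ∈ A, SHom d (f i)) : SHom d (∑ i ∈ A, f i) := by
  intro n hn
  rw [map_sum]
  exact Finset.sum_eq_zero fun i hi => h i hi n hn

theorem SHom.smul {d : ℕ} {F : Ser} (h : SHom d F) (c : ℚ) : SHom d (c • F) := by
  intro n hn
  rw [map_smul, h n hn, smul_zero]

theorem SHom.add {d : ℕ} {F G : Ser} (hF : SHom d F) (hG : SHom d G) : SHom d (F + G) := by
  intro n hn
  rw [map_add, hF n hn, hG n hn, add_zero]

theorem SHom.mul {k l : ℕ} {F G : Ser} (hF : SHom k F) (hG : SHom l G) : SHom (k + l) (F * G) := by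
  classical
  intro n hn
  rw [coeff_mul]
  refine Finset.sum_eq_zero fun p hp => ?_
  rw [Finset.HasAntidiagonal.mem_antidiagonal] at hp
  have hs : p.1 Var.s + p.2 Var.s = n Var.s := by rw [← hp]; rfl
  by_cases h : p.1 Var.s = k
  · rw [hG _ (by omega), mul_zero]
  · rw [hF _ h, zero_mul]

theorem SHom.dt {k : ℕ} {F : Ser} (hF : SHom k F) (i : ℕ+) : SHom k (dt i F) := by
  classical
  intro n hn
  rw [Ser.dt, coeff_pderiv, hF, zero_mul]
  simpa using hn

theorem sHom_X {x : Var} (hx : x ≠ Var.s) : SHom 0 (X x : Ser) := by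
  classical
  intro n hn
  rw [coeff_X, if_neg]
  rintro rfl
  exact hn (Finsupp.single_eq_of_ne hx.symm)

theorem sHom_s : SHom 1 s := by
  classical
  intro n hn
  rw [coeff_X, if_neg]
  rintro rfl
  exact hn Finsupp.single_eq_same

theorem sHom_one : SHom 0 (1 : Ser) := by
  classical
  intro n hn
  rw [coeff_one, if_neg]
  rintro rfl
  exact hn rfl

theorem SHom.generator {k : ℕ} {F : Ser} (hF : SHom k F) : SHom (k + 1) (generator F) := by
  have ht : ∀ i, SHom 0 (t i) := fun i => sHom_X (by simp)
  have hu : SHom 0 u := sHom_X (by simp)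
  have hv : SHom 0 v := sHom_X (by simp)
  have h0 : ∀ {G H : Ser}, SHom 0 G → SHom k H → SHom k (G * H) := fun hG hH => by
    simpa using hG.mul hH
  have h : SHom k ((u + v) * L F + M F + u * v * t 1 * F) := by
    refine ((h0 (hu.add hv) ?_).add ?_).add (h0 ((hu.mul hv).mul (ht 1)) hF)
    · exact SHom.sum fun i => (h0 (ht _) (hF.dt _)).smul _
    · exact SHom.sum fun i => SHom.finset_sum fun j _ =>
        ((h0 ((ht _).mul (ht _)) (hF.dt _)).smul _).add ((h0 (ht _) ((hF.dt _).dt _)).smul _)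
  rw [Ser.generator, add_comm k]
  exact sHom_s.mul h

theorem sHom_iterate_generator (n : ℕ) : SHom n (generator^[n] 1) := by
  induction n with
  | zero => exact sHom_one
  | succ n ih =>
    rw [Function.iterate_succ_apply']
    exact ih.generator

theorem coeff_opExp_generator_one (n : Var →₀ ℕ) :
    coeff n (opExp generator 1) =
      ((n Var.s).factorial : ℚ)⁻¹ * coeff n (generator^[n Var.s] 1) := by
  rw [opExp, coeff_sum, finsum_eq_single _ (n Var.s), map_smul, smul_eq_mul]
  intro k hk
  rw [map_smul, sHom_iterate_generator k n (Ne.symm hk), smul_zero]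

theorem orderGE_opExp_sub_one : OrderGE 1 (opExp generator 1 - 1) := by
  intro n hn
  rw [map_sub, coeff_opExp_generator 1 n hn]
  simp

/-- The operator exponential solves the linear evolution equation. -/
theorem s_mul_ds_opExp_generator :
    s * ds (opExp generator 1) = generator (opExp generator 1) := by
  ext n
  set P := ∑ k ∈ Finset.range (n Var.s + 1), ((k.factorial : ℚ)⁻¹) • (generator^[k] 1) with hP
  have hdiff : OrderGE (n Var.s + 1) (opExp generator 1 - P) := fun m hm => by
    rw [map_sub, coeff_opExp_generator 1 m hm, sub_self]
  have h1 : coeff n (generator (opExp generator 1)) = coeff n (generator P) := by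
    have := hdiff.generator n (by omega)
    rwa [generator_sub, map_sub, sub_eq_zero] at this
  rw [h1, coeff_s_mul_ds, coeff_opExp_generator_one, hP, generator_sum, map_sum]
  have h2 : ∀ k, coeff n (generator ((k.factorial : ℚ)⁻¹ • generator^[k] 1)) =
      (k.factorial : ℚ)⁻¹ * coeff n (generator^[k + 1] 1) := fun k => by
    rw [generator_smul, map_smul, smul_eq_mul, Function.iterate_succ_apply']
  rw [Finset.sum_congr rfl fun k _ => h2 k]
  rcases Nat.eq_zero_or_pos (n Var.s) with hz | hz
  · rw [hz]
    have h3 : coeff n (generator 1) = 0 := sHom_iterate_generator 1 n (by omega)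
    simp [h3]
  · obtain ⟨d, hd⟩ : ∃ d, n Var.s = d + 1 := ⟨n Var.s - 1, by omega⟩
    rw [Finset.sum_eq_single d]
    · rw [hd, Nat.factorial_succ]
      have : (d.factorial : ℚ) ≠ 0 := by exact_mod_cast d.factorial_ne_zero
      have h3 : ((d : ℚ) + 1) ≠ 0 := by positivity
      push_cast
      field_simp
    · intro k _ hk
      rw [sHom_iterate_generator (k + 1) n (by omega), mul_zero]
    · intro hd'
      exact absurd (Finset.mem_range.2 (by omega)) hd'

theorem evolutionEquation_iff {G : Ser} (hG : OrderGE 1 G) :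
    EvolutionEquation G ↔ exp G = opExp generator 1 := by
  have hgen : generator (exp G) =
      exp G * (s * ((u + v) * L G + M G + Q G + u * v * t 1)) :=
    generator_of_dt_eq fun i => pderiv_exp hG _
  have hds : s * ds (exp G) = exp G * (s * ds G) := by
    rw [ds, pderiv_exp hG]
    ring
  constructor
  · intro h
    rw [EvolutionEquation] at h
    rw [← sub_eq_zero]
    refine eq_zero_of_euler (R := generator (exp G - opExp generator 1)) ?_ ?_
      fun k hk => hk.generator
    · intro n hn
      have h1 := orderGE_exp_sub_one hG n hn
      have h2 := orderGE_opExp_sub_one n hn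
      rw [map_sub] at h1 h2 ⊢
      linarith
    · rw [generator_sub, hgen, ← s_mul_ds_opExp_generator, ← h, ← hds]
      simp only [ds, map_sub]
      ring
  · intro h
    have h1 : s * ds (exp G) = generator (exp G) := by rw [h, s_mul_ds_opExp_generator]
    rw [hds, hgen] at h1
    exact s_mul_cancel (mul_left_cancel₀ (exp_ne_zero hG) h1)

/-- The exponential formula: if `F` and `Z` are the exponential generating functions in `s` of the
sequences `C` and `A`, and an `A`-structure on a pointed set is a `C`-structure on a subset
containing the point together with an `A`-structure on its complement, then `e^F = Z`. -/
theorem exp_eq_opExp_of_convolution {F : Ser} {A C : ℕ → Ser} (hF : OrderGE 1 F)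
    (hA : ∀ d, A d = generator^[d] 1)
    (hFC : ∀ n : Var →₀ ℕ, coeff n F = ((n Var.s).factorial : ℚ)⁻¹ * coeff n (C (n Var.s)))
    (hconv : ∀ d, A (d + 1) =
      ∑ a ∈ Finset.range (d + 1), d.choose a • (A a * C (d + 1 - a))) :
    exp F = opExp generator 1 := by
  classical
  set Z := opExp generator 1 with hZ
  have hZA : ∀ n, coeff n Z = ((n Var.s).factorial : ℚ)⁻¹ * coeff n (A (n Var.s)) := fun n => by
    rw [hZ, coeff_opExp_generator_one, hA]
  have hAh : ∀ d, SHom d (A d) := fun d => by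
    rw [hA]
    exact sHom_iterate_generator d
  have hDZ : s * ds Z = Z * (s * ds F) := by
    have hK := coeff_s_mul_ds F
    generalize s * ds F = K at hK ⊢
    ext n
    rw [coeff_s_mul_ds, coeff_mul, hZA]
    rcases Nat.eq_zero_or_pos (n Var.s) with hz | hz
    · rw [hz, Nat.cast_zero, zero_mul, eq_comm]
      refine Finset.sum_eq_zero fun p hp => ?_
      rw [Finset.HasAntidiagonal.mem_antidiagonal] at hp
      have hs : p.1 Var.s + p.2 Var.s = n Var.s := by rw [← hp]; rfl
      rw [hK, (by omega : p.2 Var.s = 0), Nat.cast_zero, zero_mul, mul_zero]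
    · obtain ⟨d, hd⟩ : ∃ d, n Var.s = d + 1 := ⟨n Var.s - 1, by omega⟩
      rw [hd, hconv, map_sum, Finset.mul_sum, Finset.mul_sum]
      simp only [map_nsmul, coeff_mul, Finset.smul_sum, Finset.mul_sum]
      rw [Finset.sum_comm]
      refine Finset.sum_congr rfl fun p hp => ?_
      rw [Finset.HasAntidiagonal.mem_antidiagonal] at hp
      have hs : p.1 Var.s + p.2 Var.s = d + 1 := by rw [← hd, ← hp]; rfl
      rw [hK, hZA, hFC]
      rcases Nat.eq_zero_or_pos (p.2 Var.s) with hz2 | hz2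
      · rw [hz2, Nat.cast_zero, zero_mul, mul_zero]
        refine Finset.sum_eq_zero fun a ha => ?_
        rw [hAh a p.1 (by have := Finset.mem_range.1 ha; omega)]
        simp
      · rw [Finset.sum_eq_single (p.1 Var.s)]
        · obtain ⟨b, hb⟩ : ∃ b, p.2 Var.s = b + 1 := ⟨p.2 Var.s - 1, by omega⟩
          have hdb : d = p.1 Var.s + b := by omega
          rw [(by omega : d + 1 - p.1 Var.s = p.2 Var.s), hb, nsmul_eq_mul, hdb,
            Nat.cast_choose ℚ (by omega : p.1 Var.s ≤ p.1 Var.s + b), Nat.add_sub_cancel_left,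
            Nat.factorial_succ, Nat.factorial_succ]
          have h1 : (b.factorial : ℚ) ≠ 0 := by exact_mod_cast b.factorial_ne_zero
          have h2 : ((p.1 Var.s).factorial : ℚ) ≠ 0 := by
            exact_mod_cast (p.1 Var.s).factorial_ne_zero
          have h3 : ((p.1 Var.s + b).factorial : ℚ) ≠ 0 := by
            exact_mod_cast (p.1 Var.s + b).factorial_ne_zero
          have h4 : ((p.1 Var.s + b : ℕ) : ℚ) + 1 ≠ 0 := by positivity
          have h5 : (b : ℚ) + 1 ≠ 0 := by positivity
          push_cast at h4 ⊢
          field_simp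
        · intro a _ ha
          rw [hAh a p.1 (Ne.symm ha)]
          simp
        · intro h
          exact absurd (Finset.mem_range.2 (by omega)) h
  rw [← sub_eq_zero]
  refine eq_zero_of_euler (R := (exp F - Z) * (s * ds F)) ?_ ?_ fun k hk => hk.mul ?_
  · intro n hn
    have h1 := orderGE_exp_sub_one hF n hn
    have h2 := orderGE_opExp_sub_one n hn
    rw [map_sub] at h1 h2 ⊢
    linarith
  · rw [sub_mul, ← hDZ]
    simp only [ds, map_sub]
    rw [pderiv_exp hF]
    ring
  · intro n hn
    rw [coeff_s_mul_ds, hF n hn, mul_zero]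

end Ser

/-! ### Cycles of a permutation, fixed points included -/

open Equiv

section Cycles

theorem prod_image_map {X Y : Type} [DecidableEq Y] {R : Type} [CommRing R] (f : X ↪ Y) (A : Finset (Finset X)) (x : ℕ → R) :
    ∏ O ∈ A.image (Finset.map f), x O.card = ∏ O ∈ A, x O.card := by
  rw [Finset.prod_image fun O _ O' _ h => Finset.map_injective f h]
  simp

theorem image_map_erase {X Y : Type} [DecidableEq X] [DecidableEq Y] (f : X ↪ Y) (A : Finset (Finset X)) (O : Finset X) :
    (A.image (Finset.map f)).erase (O.map f) = (A.erase O).image (Finset.map f) :=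
  (Finset.image_erase (Finset.map_injective f) A O).symm

variable {X Y : Type} [Fintype X] [DecidableEq X] [Fintype Y] [DecidableEq Y]
variable {R : Type} [CommRing R]

/-- The cycle of a permutation through a point, as a set of points (a singleton if the point is
fixed). -/
def cyc (σ : Perm Y) (x : Y) : Finset Y := Finset.univ.filter (σ.SameCycle x)

/-- The set of all cycles of a permutation, fixed points included. -/
def cycles (σ : Perm Y) : Finset (Finset Y) := Finset.univ.image (cyc σ)

/-- The weight `∏ x_{|O|}` over the cycles `O` of a permutation, fixed points included. -/
def cycleWeight (x : ℕ → R) (σ : Perm Y) : R := ∏ O ∈ cycles σ, x O.card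

theorem mem_cyc {σ : Perm Y} {x y : Y} : y ∈ cyc σ x ↔ σ.SameCycle x y := by
  simp [cyc]

theorem self_mem_cyc (σ : Perm Y) (x : Y) : x ∈ cyc σ x := mem_cyc.2 (Perm.SameCycle.refl σ x)

theorem cyc_eq_cyc_iff {σ : Perm Y} {x y : Y} : cyc σ x = cyc σ y ↔ σ.SameCycle x y := by
  constructor
  · intro h
    rw [← mem_cyc, h]
    exact self_mem_cyc σ y
  · intro h
    ext z
    rw [mem_cyc, mem_cyc]
    exact ⟨fun hz => h.symm.trans hz, fun hz => h.trans hz⟩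

theorem cyc_mem_cycles (σ : Perm Y) (x : Y) : cyc σ x ∈ cycles σ :=
  Finset.mem_image_of_mem _ (Finset.mem_univ x)

theorem mem_cycles {σ : Perm Y} {O : Finset Y} : O ∈ cycles σ ↔ ∃ x, cyc σ x = O := by
  simp [cycles]

theorem eq_cyc_of_mem {σ : Perm Y} {O : Finset Y} (hO : O ∈ cycles σ) {x : Y} (hx : x ∈ O) :
    O = cyc σ x := by
  obtain ⟨y, rfl⟩ := mem_cycles.1 hO
  exact cyc_eq_cyc_iff.2 (mem_cyc.1 hx)

theorem card_pos_of_mem_cycles {σ : Perm Y} {O : Finset Y} (hO : O ∈ cycles σ) : 0 < O.card := by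
  obtain ⟨y, rfl⟩ := mem_cycles.1 hO
  exact Finset.card_pos.2 ⟨y, self_mem_cyc σ y⟩

theorem apply_mem_cyc {σ : Perm Y} {x y : Y} (h : y ∈ cyc σ x) : σ y ∈ cyc σ x := by
  rw [mem_cyc] at h ⊢
  exact h.apply_right

theorem cyc_subset_of_invariant {σ : Perm Y} {A : Finset Y} (hA : ∀ y ∈ A, σ y ∈ A) {x : Y}
    (hx : x ∈ A) : cyc σ x ⊆ A := by
  intro y hy
  obtain ⟨n, rfl⟩ := (mem_cyc.1 hy).exists_nat_pow_eq
  clear hy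
  induction n with
  | zero => exact hx
  | succ n ih => rw [pow_succ', Perm.mul_apply]; exact hA _ ih

theorem cyc_congr {σ τ : Perm Y} {x : Y} (h : ∀ y ∈ cyc σ x, τ y = σ y) : cyc τ x = cyc σ x := by
  have h1 : ∀ n : ℕ, (τ ^ n) x = (σ ^ n) x := fun n => by
    induction n with
    | zero => rfl
    | succ n ih =>
      rw [pow_succ', pow_succ', Perm.mul_apply, Perm.mul_apply, ih, h]
      exact mem_cyc.2 ⟨n, by simp⟩
  ext y
  rw [mem_cyc, mem_cyc]
  constructor
  · intro hy
    obtain ⟨n, rfl⟩ := hy.exists_nat_pow_eq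
    rw [h1]
    exact ⟨n, by simp⟩
  · intro hy
    obtain ⟨n, rfl⟩ := hy.exists_nat_pow_eq
    rw [← h1]
    exact ⟨n, by simp⟩

theorem cyc_map {γ : Perm X} {σ : Perm Y} (f : X ↪ Y) (h : ∀ x, σ (f x) = f (γ x)) (x : X) :
    cyc σ (f x) = (cyc γ x).map f := by
  have h1 : ∀ n : ℕ, (σ ^ n) (f x) = f ((γ ^ n) x) := fun n => by
    induction n with
    | zero => rfl
    | succ n ih => rw [pow_succ', pow_succ', Perm.mul_apply, Perm.mul_apply, ih, h]
  ext y
  rw [mem_cyc, Finset.mem_map]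
  constructor
  · intro hy
    obtain ⟨n, rfl⟩ := hy.exists_nat_pow_eq
    exact ⟨(γ ^ n) x, mem_cyc.2 ⟨n, by simp⟩, (h1 n).symm⟩
  · rintro ⟨z, hz, rfl⟩
    obtain ⟨n, rfl⟩ := (mem_cyc.1 hz).exists_nat_pow_eq
    rw [← h1]
    exact ⟨n, by simp⟩

theorem cycles_permCongr (e : X ≃ Y) (γ : Perm X) :
    cycles (e.permCongr γ) = (cycles γ).image (Finset.map e.toEmbedding) := by
  ext O
  simp only [cycles, Finset.image_image, Finset.mem_image, Finset.mem_univ, true_and,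
    Function.comp]
  constructor
  · rintro ⟨y, rfl⟩
    refine ⟨e.symm y, ?_⟩
    rw [← cyc_map (σ := e.permCongr γ) e.toEmbedding (by simp)]
    simp
  · rintro ⟨z, rfl⟩
    exact ⟨e z, cyc_map (σ := e.permCongr γ) e.toEmbedding (by simp) z⟩

theorem cycleWeight_permCongr (e : X ≃ Y) (γ : Perm X) (x : ℕ → R) :
    cycleWeight x (e.permCongr γ) = cycleWeight x γ := by
  rw [cycleWeight, cycles_permCongr, prod_image_map, cycleWeight]

theorem cycles_inv (σ : Perm Y) : cycles σ⁻¹ = cycles σ := by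
  have h : cyc σ⁻¹ = cyc σ := by
    funext x
    ext y
    simp [mem_cyc]
  rw [cycles, h, cycles]

theorem card_cyc_eq {σ : Perm Y} {O : Finset Y} (hO : O ∈ cycles σ) :
    (Finset.univ.filter fun y => cyc σ y = O).card = O.card := by
  congr 1
  ext y
  simp only [Finset.mem_filter, Finset.mem_univ, true_and]
  exact ⟨fun h => h ▸ self_mem_cyc σ y, fun h => (eq_cyc_of_mem hO h).symm⟩

theorem sum_cyc (σ : Perm Y) (g : Finset Y → R) :
    ∑ y, g (cyc σ y) = ∑ O ∈ cycles σ, O.card • g O := by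
  rw [Finset.sum_comp g (cyc σ)]
  exact Finset.sum_congr rfl fun O hO => by rw [card_cyc_eq hO]

theorem sum_cyc_of_notMem (σ : Perm Y) {O : Finset Y} (hO : O ∈ cycles σ) (g : Finset Y → R) :
    ∑ y ∈ Finset.univ.filter (· ∉ O), g (cyc σ y) =
      ∑ O' ∈ (cycles σ).erase O, O'.card • g O' := by
  have h := sum_cyc σ fun O' => if O' = O then 0 else g O'
  rw [← Finset.add_sum_erase _ _ hO] at h
  simp only [if_true, smul_zero, zero_add] at h
  rw [Finset.sum_filter]
  refine (Finset.sum_congr rfl fun y _ => ?_).trans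
    (h.trans (Finset.sum_congr rfl fun O' hO' => by rw [if_neg (Finset.ne_of_mem_erase hO')]))
  by_cases hy : y ∈ O
  · rw [if_neg (not_not.2 hy), if_pos (eq_cyc_of_mem hO hy).symm]
  · rw [if_pos hy, if_neg fun h' : cyc σ y = O => hy (h' ▸ self_mem_cyc σ y)]

/-! ### Multiplication by a transposition: join and cut -/

theorem cyc_subset_cyc_swap_mul {σ : Perm Y} {p i : Y} (h : ¬σ.SameCycle p i) :
    cyc σ p ⊆ cyc (swap p i * σ) p := by
  intro y hy
  obtain ⟨n, rfl⟩ := (mem_cyc.1 hy).exists_nat_pow_eq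
  clear hy
  induction n with
  | zero => exact self_mem_cyc _ _
  | succ n ih =>
    by_cases hp : (σ ^ (n + 1)) p = p
    · rw [hp]
      exact self_mem_cyc _ _
    · have hi : (σ ^ (n + 1)) p ≠ i := fun hi => h ⟨(n + 1 : ℕ), by rw [zpow_natCast]; exact hi⟩
      have := apply_mem_cyc ih
      rwa [Perm.mul_apply, ← Perm.mul_apply σ, ← pow_succ', swap_apply_of_ne_of_ne hp hi] at this

theorem cyc_swap_mul {σ : Perm Y} {p i : Y} (h : ¬σ.SameCycle p i) :
    cyc (swap p i * σ) p = cyc σ p ∪ cyc σ i := by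
  apply Finset.Subset.antisymm
  · refine cyc_subset_of_invariant ?_ (Finset.mem_union_left _ (self_mem_cyc σ p))
    intro y hy
    rw [Perm.mul_apply]
    have hσ : σ y ∈ cyc σ p ∪ cyc σ i := by
      rw [Finset.mem_union] at hy ⊢
      exact hy.imp apply_mem_cyc apply_mem_cyc
    by_cases h1 : σ y = p
    · rw [h1, swap_apply_left]
      exact Finset.mem_union_right _ (self_mem_cyc σ i)
    · by_cases h2 : σ y = i
      · rw [h2, swap_apply_right]
        exact Finset.mem_union_left _ (self_mem_cyc σ p)
      · rwa [swap_apply_of_ne_of_ne h1 h2]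
  · have hp : cyc σ p ⊆ cyc (swap p i * σ) p := cyc_subset_cyc_swap_mul h
    have hi : cyc σ i ⊆ cyc (swap p i * σ) i := by
      have := cyc_subset_cyc_swap_mul (fun h' => h (Perm.SameCycle.symm h') : ¬σ.SameCycle i p)
      rwa [swap_comm i p] at this
    have hpi : (swap p i * σ).SameCycle p i := by
      have h1 : σ⁻¹ p ∈ cyc (swap p i * σ) p := hp (mem_cyc.2 ⟨-1, by simp⟩)
      have h2 := apply_mem_cyc h1
      rw [Perm.mul_apply, (by simp : σ (σ⁻¹ p) = p), swap_apply_left] at h2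
      exact mem_cyc.1 h2
    rw [← cyc_eq_cyc_iff.2 hpi] at hi
    exact Finset.union_subset hp hi

theorem cyc_swap_mul_of_notMem {σ : Perm Y} {p i y : Y} (hp : ¬σ.SameCycle p y)
    (hi : ¬σ.SameCycle i y) : cyc (swap p i * σ) y = cyc σ y := by
  refine cyc_congr fun z hz => ?_
  have hz' := mem_cyc.1 (apply_mem_cyc hz)
  rw [Perm.mul_apply, swap_apply_of_ne_of_ne]
  · intro h
    exact hp (h ▸ hz'.symm)
  · intro h
    exact hi (h ▸ hz'.symm)

/-- Multiplying by the transposition of two points of different cycles joins these cycles. -/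
theorem cycles_swap_mul {σ : Perm Y} {p i : Y} (h : ¬σ.SameCycle p i) :
    cycles (swap p i * σ) =
      insert (cyc σ p ∪ cyc σ i) (((cycles σ).erase (cyc σ p)).erase (cyc σ i)) := by
  have hpi := cyc_swap_mul h
  ext O
  rw [Finset.mem_insert, Finset.mem_erase, Finset.mem_erase]
  constructor
  · intro hO
    obtain ⟨y, rfl⟩ := mem_cycles.1 hO
    by_cases hy : y ∈ cyc σ p ∪ cyc σ i
    · left
      rw [← hpi, cyc_eq_cyc_iff]
      exact (mem_cyc.1 (hpi ▸ hy)).symm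
    · rw [Finset.mem_union, not_or, mem_cyc, mem_cyc] at hy
      right
      rw [cyc_swap_mul_of_notMem hy.1 hy.2]
      exact ⟨fun h' => hy.2 (cyc_eq_cyc_iff.1 h').symm, fun h' => hy.1 (cyc_eq_cyc_iff.1 h').symm,
        cyc_mem_cycles σ y⟩
  · rintro (rfl | ⟨h1, h2, h3⟩)
    · rw [← hpi]
      exact cyc_mem_cycles _ _
    · obtain ⟨y, rfl⟩ := mem_cycles.1 h3
      rw [← cyc_swap_mul_of_notMem (p := p) (i := i) (fun h' => h2 (cyc_eq_cyc_iff.2 h'.symm))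
        (fun h' => h1 (cyc_eq_cyc_iff.2 h'.symm))]
      exact cyc_mem_cycles _ _

theorem disjoint_cyc {σ : Perm Y} {p i : Y} (h : ¬σ.SameCycle p i) :
    Disjoint (cyc σ p) (cyc σ i) := by
  rw [Finset.disjoint_left]
  intro y hp hi
  exact h ((mem_cyc.1 hp).trans (mem_cyc.1 hi).symm)

theorem union_notMem_erase {σ : Perm Y} {p i : Y} :
    cyc σ p ∪ cyc σ i ∉ ((cycles σ).erase (cyc σ p)).erase (cyc σ i) := by
  intro h
  have h1 := Finset.mem_of_mem_erase h
  have h2 := Finset.mem_of_mem_erase h1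
  exact Finset.ne_of_mem_erase h1
    (eq_cyc_of_mem h2 (Finset.mem_union_left _ (self_mem_cyc σ p)))

theorem cycleWeight_join (x : ℕ → R) {σ : Perm Y} {p i : Y} (h : ¬σ.SameCycle p i) :
    cycleWeight x (swap p i * σ) = x ((cyc σ p).card + (cyc σ i).card) *
      ∏ O ∈ ((cycles σ).erase (cyc σ p)).erase (cyc σ i), x O.card := by
  rw [cycleWeight, cycles_swap_mul h, Finset.prod_insert union_notMem_erase,
    Finset.card_union_of_disjoint (disjoint_cyc h)]

theorem isCycleOn_cyc (σ : Perm Y) (p : Y) : σ.IsCycleOn (cyc σ p : Set Y) := by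
  have : (cyc σ p : Set Y) = {y | σ.SameCycle p y} := by
    ext y
    simp [mem_cyc]
  rw [this]
  refine ⟨?_, fun a ha b hb => Perm.SameCycle.trans (Perm.SameCycle.symm ha) hb⟩
  refine ⟨fun y hy => Perm.SameCycle.apply_right hy, σ.injective.injOn, fun y hy => ?_⟩
  exact ⟨σ⁻¹ y, Perm.SameCycle.trans hy ⟨-1, by simp⟩, by simp⟩

theorem pow_apply_injOn (σ : Perm Y) (p : Y) {a b : ℕ} (ha : a < (cyc σ p).card)
    (hb : b < (cyc σ p).card) (h : (σ ^ a) p = (σ ^ b) p) : a = b := by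
  have h1 := ((isCycleOn_cyc σ p).pow_apply_eq_pow_apply (self_mem_cyc σ p)).1 h
  exact Nat.ModEq.eq_of_lt_of_lt h1 ha hb

/-- Multiplying by the transposition of two points of one cycle cuts this cycle; the part through
the point `p` consists of the `a` points preceding `σ^a p`. -/
theorem cyc_cut (σ : Perm Y) (p : Y) {a : ℕ} (h0 : 0 < a) (ha : a < (cyc σ p).card) :
    cyc (swap p ((σ ^ a) p) * σ) p = (Finset.range a).image fun m => (σ ^ m) p := by
  have hp0 : p = (σ ^ 0) p := rfl
  have hτ : ∀ m, m + 1 < a → (swap p ((σ ^ a) p) * σ) ((σ ^ m) p) = (σ ^ (m + 1)) p := by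
    intro m hm
    rw [Perm.mul_apply, ← Perm.mul_apply σ, ← pow_succ']
    refine swap_apply_of_ne_of_ne (fun h => ?_) fun h => ?_
    · have := pow_apply_injOn σ p (b := 0) (by omega) (by omega) h
      omega
    · have := pow_apply_injOn σ p (by omega) (by omega) h
      omega
  apply Finset.Subset.antisymm
  · refine cyc_subset_of_invariant (fun y hy => ?_)
      (Finset.mem_image.2 ⟨0, Finset.mem_range.2 h0, rfl⟩)
    obtain ⟨m, hm, rfl⟩ := Finset.mem_image.1 hy
    rw [Finset.mem_range] at hm
    rw [Finset.mem_image]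
    by_cases h : m + 1 < a
    · exact ⟨m + 1, Finset.mem_range.2 h, (hτ m h).symm⟩
    · refine ⟨0, Finset.mem_range.2 h0, ?_⟩
      rw [Perm.mul_apply, ← Perm.mul_apply σ, ← pow_succ', (by omega : m + 1 = a),
        swap_apply_right]
      rfl
  · intro y hy
    obtain ⟨m, hm, rfl⟩ := Finset.mem_image.1 hy
    rw [Finset.mem_range] at hm
    clear hy
    induction m with
    | zero => exact self_mem_cyc _ _
    | succ m ih =>
      rw [← hτ m hm]
      exact apply_mem_cyc (ih (by omega))

theorem cycleWeight_cut (x : ℕ → R) (σ : Perm Y) (p : Y) {a : ℕ} (h0 : 0 < a)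
    (ha : a < (cyc σ p).card) :
    cycleWeight x (swap p ((σ ^ a) p) * σ) = x a * x ((cyc σ p).card - a) *
      ∏ O ∈ (cycles σ).erase (cyc σ p), x O.card := by
  set i := (σ ^ a) p with hi
  set τ := swap p i * σ with hτ
  have hcyc : cyc τ p = (Finset.range a).image fun m => (σ ^ m) p := cyc_cut σ p h0 ha
  have hcard : (cyc τ p).card = a := by
    rw [hcyc, Finset.card_image_of_injOn, Finset.card_range]
    intro m hm m' hm' h
    rw [Finset.coe_range, Set.mem_Iio] at hm hm'
    exact pow_apply_injOn σ p (by omega) (by omega) h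
  have hnot : ¬τ.SameCycle p i := by
    rw [← mem_cyc, hcyc, Finset.mem_image]
    rintro ⟨m, hm, h⟩
    rw [Finset.mem_range] at hm
    have := pow_apply_injOn σ p (by omega) ha h
    omega
  have hσ : swap p i * τ = σ := by rw [hτ, swap_mul_self_mul]
  have hunion : cyc σ p = cyc τ p ∪ cyc τ i := by
    rw [← cyc_swap_mul hnot, hσ]
  have hcardi : (cyc τ i).card = (cyc σ p).card - a := by
    rw [hunion, Finset.card_union_of_disjoint (disjoint_cyc hnot), hcard, Nat.add_sub_cancel_left]
  have herase : (cycles σ).erase (cyc σ p) = ((cycles τ).erase (cyc τ p)).erase (cyc τ i) := by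
    rw [← hσ, cycles_swap_mul hnot, hσ, hunion, Finset.erase_insert union_notMem_erase]
  have hmem : cyc τ i ∈ (cycles τ).erase (cyc τ p) :=
    Finset.mem_erase.2 ⟨fun h => hnot (cyc_eq_cyc_iff.1 h).symm, cyc_mem_cycles τ i⟩
  rw [herase, cycleWeight, ← Finset.mul_prod_erase _ _ (cyc_mem_cycles τ p),
    ← Finset.mul_prod_erase _ _ hmem, hcard, hcardi, mul_assoc]

theorem sum_cycleWeight_cut (x : ℕ → R) (σ : Perm Y) (p : Y) :
    ∑ i ∈ (cyc σ p).erase p, cycleWeight x (swap p i * σ) =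
      (∑ a ∈ Finset.Ico 1 (cyc σ p).card, x a * x ((cyc σ p).card - a)) *
        ∏ O ∈ (cycles σ).erase (cyc σ p), x O.card := by
  rw [Finset.sum_mul]
  symm
  refine Finset.sum_bij (fun a _ => (σ ^ a) p) ?_ ?_ ?_ ?_
  · intro a ha
    rw [Finset.mem_Ico] at ha
    refine Finset.mem_erase.2 ⟨fun h => ?_, mem_cyc.2 ⟨a, by simp⟩⟩
    have := pow_apply_injOn σ p (b := 0) ha.2 (by omega) h
    omega
  · intro a ha b hb h
    rw [Finset.mem_Ico] at ha hb
    exact pow_apply_injOn σ p ha.2 hb.2 h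
  · intro i hi
    obtain ⟨hne, hi⟩ := Finset.mem_erase.1 hi
    obtain ⟨n, hn, rfl⟩ := (isCycleOn_cyc σ p).exists_pow_eq (self_mem_cyc σ p) hi
    refine ⟨n, Finset.mem_Ico.2 ⟨?_, hn⟩, rfl⟩
    rcases Nat.eq_zero_or_pos n with rfl | h
    · exact absurd rfl hne
    · exact h
  · intro a ha
    rw [Finset.mem_Ico] at ha
    rw [cycleWeight_cut x σ p ha.1 ha.2]

/-! ### Adding a point to a permutation -/

/-- The embedding of a type into its extension by one point. -/
abbrev someEmb (X : Type) : X ↪ Option X := Function.Embedding.some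

theorem cyc_optionCongr_some (γ : Perm X) (x : X) :
    cyc (optionCongr γ) (some x) = (cyc γ x).map (someEmb X) :=
  cyc_map (someEmb X) (by simp) x

theorem cyc_optionCongr_none (γ : Perm X) : cyc (optionCongr γ) none = {none} := by
  apply Finset.Subset.antisymm
  · exact cyc_subset_of_invariant (by simp) (by simp)
  · simp [self_mem_cyc]

theorem not_sameCycle_none (γ : Perm X) (x : X) :
    ¬Perm.SameCycle (optionCongr γ) none (some x) := by
  rw [← mem_cyc, cyc_optionCongr_none]
  simp

theorem cycles_optionCongr_erase (γ : Perm X) :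
    (cycles (optionCongr γ)).erase (cyc (optionCongr γ) none) =
      (cycles γ).image (Finset.map (someEmb X)) := by
  ext O
  rw [Finset.mem_erase, mem_cycles, Finset.mem_image]
  constructor
  · rintro ⟨hne, y, rfl⟩
    cases y with
    | none => exact absurd rfl hne
    | some x => exact ⟨_, cyc_mem_cycles γ x, (cyc_optionCongr_some γ x).symm⟩
  · rintro ⟨O', hO', rfl⟩
    obtain ⟨x, rfl⟩ := mem_cycles.1 hO'
    rw [← cyc_optionCongr_some]
    exact ⟨fun h => not_sameCycle_none γ x (cyc_eq_cyc_iff.1 h.symm), some x, rfl⟩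

theorem cycleWeight_optionCongr (x : ℕ → R) (γ : Perm X) :
    cycleWeight x (optionCongr γ) = x 1 * cycleWeight x γ := by
  rw [cycleWeight, ← Finset.mul_prod_erase _ _ (cyc_mem_cycles _ none), cycles_optionCongr_erase,
    prod_image_map, cyc_optionCongr_none, Finset.card_singleton, cycleWeight]

theorem cycleWeight_insert (x : ℕ → R) (γ : Perm X) (j : X) :
    cycleWeight x (swap none (some j) * optionCongr γ) =
      x ((cyc γ j).card + 1) * ∏ O ∈ (cycles γ).erase (cyc γ j), x O.card := by
  rw [cycleWeight_join x (not_sameCycle_none γ j), cycles_optionCongr_erase,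
    cyc_optionCongr_some, image_map_erase, prod_image_map, cyc_optionCongr_none, Finset.card_map,
    Finset.card_singleton, add_comm]

theorem cycleWeight_const_insert (x : R) (γ : Perm X) (j : X) :
    cycleWeight (fun _ => x) (swap none (some j) * optionCongr γ) =
      cycleWeight (fun _ => x) γ := by
  rw [cycleWeight_insert, cycleWeight, ← Finset.mul_prod_erase _ _ (cyc_mem_cycles γ j)]

/-- Inserting a new point into a cycle of a permutation, in all possible ways. -/
theorem sum_cycleWeight_insert (x : ℕ → R) (γ : Perm X) :
    ∑ j, cycleWeight x (swap none (some j) * optionCongr γ) =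
      ∑ O ∈ cycles γ, O.card • (x (O.card + 1) * ∏ O' ∈ (cycles γ).erase O, x O'.card) := by
  simp only [cycleWeight_insert]
  exact sum_cyc γ fun O => x (O.card + 1) * ∏ O' ∈ (cycles γ).erase O, x O'.card

/-- Inserting a new point into a cycle of a permutation and multiplying by a further transposition
involving the new point, in all possible ways: the new cycle is cut into two or joined with another
cycle. -/
theorem sum_cycleWeight_insert_swap (x : ℕ → R) (γ : Perm X) :
    ∑ j, ∑ i, cycleWeight x (swap none (some i) * (swap none (some j) * optionCongr γ)) =
      ∑ O ∈ cycles γ, O.card •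
        ((∑ a ∈ Finset.Ico 1 (O.card + 1), x a * x (O.card + 1 - a)) *
            ∏ O' ∈ (cycles γ).erase O, x O'.card +
          ∑ O' ∈ (cycles γ).erase O, O'.card • (x (O.card + 1 + O'.card) *
            ∏ O'' ∈ ((cycles γ).erase O).erase O', x O''.card)) := by
  rw [← sum_cyc γ fun O => (∑ a ∈ Finset.Ico 1 (O.card + 1), x a * x (O.card + 1 - a)) *
            ∏ O' ∈ (cycles γ).erase O, x O'.card +
          ∑ O' ∈ (cycles γ).erase O, O'.card • (x (O.card + 1 + O'.card) *
            ∏ O'' ∈ ((cycles γ).erase O).erase O', x O''.card)]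
  refine Finset.sum_congr rfl fun j _ => ?_
  set σ : Perm (Option X) := optionCongr γ
  set ρ := swap none (some j) * σ with hρ
  have hns : ¬σ.SameCycle none (some j) := not_sameCycle_none γ j
  have hcyc : cyc ρ none = insert none ((cyc γ j).map (someEmb X)) := by
    rw [hρ, cyc_swap_mul hns, cyc_optionCongr_none, cyc_optionCongr_some]
    rfl
  have hcard : (cyc ρ none).card = (cyc γ j).card + 1 := by
    rw [hcyc, Finset.card_insert_of_notMem (by simp), Finset.card_map]
  have herase : (cycles ρ).erase (cyc ρ none) =
      ((cycles γ).erase (cyc γ j)).image (Finset.map (someEmb X)) := by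
    rw [hρ, cycles_swap_mul hns, cyc_swap_mul hns, Finset.erase_insert union_notMem_erase,
      cycles_optionCongr_erase, cyc_optionCongr_some, image_map_erase]
  rw [← Finset.sum_filter_add_sum_filter_not Finset.univ (· ∈ cyc γ j)]
  congr 1
  · have h := sum_cycleWeight_cut x ρ none
    rw [herase, prod_image_map, hcard] at h
    rw [← h, hcyc, Finset.erase_insert (by simp), Finset.sum_map]
    exact Finset.sum_congr (by ext; simp) fun _ _ => rfl
  · rw [← sum_cyc_of_notMem γ (cyc_mem_cycles γ j) fun O' => x ((cyc γ j).card + 1 + O'.card) *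
      ∏ O'' ∈ ((cycles γ).erase (cyc γ j)).erase O', x O''.card]
    refine Finset.sum_congr rfl fun i hi => ?_
    have hi' : ¬γ.SameCycle j i := by
      rw [← mem_cyc]
      exact (Finset.mem_filter.1 hi).2
    have hni : ¬ρ.SameCycle none (some i) := by
      rw [← mem_cyc, hcyc]
      simpa [mem_cyc] using hi'
    have hci : cyc ρ (some i) = (cyc γ i).map (someEmb X) := by
      rw [hρ, cyc_swap_mul_of_notMem (not_sameCycle_none γ i), cyc_optionCongr_some]
      rw [← mem_cyc, cyc_optionCongr_some]
      simpa [mem_cyc] using hi'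
    rw [cycleWeight_join x hni, herase, hci, image_map_erase, prod_image_map, hcard,
      Finset.card_map]

end Cycles

/-! ### The operators `L₁` and `M₁` on monomials in the `tᵢ` -/

namespace Ser

theorem derivation_prod {ι : Type} [DecidableEq ι] (D : Derivation ℚ Ser Ser) (A : Finset ι)
    (f : ι → Ser) : D (∏ a ∈ A, f a) = ∑ a ∈ A, (∏ b ∈ A.erase a, f b) * D (f a) := by
  induction A using Finset.induction_on with
  | empty => simp
  | insert a A ha ih =>
    rw [Finset.prod_insert ha, Derivation.leibniz, ih, Finset.sum_insert ha,
      Finset.erase_insert ha, smul_eq_mul, smul_eq_mul, Finset.mul_sum, add_comm]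
    congr 1
    refine Finset.sum_congr rfl fun b hb => ?_
    rw [Finset.erase_insert_of_ne (by rintro rfl; exact ha hb),
      Finset.prod_insert (fun h => ha (Finset.mem_of_mem_erase h)), mul_assoc]

theorem dt_t (i j : ℕ+) : dt i (t j) = if j = i then 1 else 0 := by
  classical
  rw [dt, t, pderiv_X]
  simp [Pi.single_apply, eq_comm]

theorem dt_prod_t {ι : Type} [DecidableEq ι] (i : ℕ+) (A : Finset ι) (κ : ι → ℕ+) :
    dt i (∏ a ∈ A, t (κ a)) = ∑ a ∈ A, if κ a = i then ∏ b ∈ A.erase a, t (κ b) else 0 := by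
  rw [dt, derivation_prod]
  refine Finset.sum_congr rfl fun a _ => ?_
  rw [← dt, dt_t, mul_ite, mul_one, mul_zero]

theorem summable_ite {ι : Type} [DecidableEq ι] (a : ι) (F : Ser) :
    Summable (fun i => if i = a then F else 0) := by
  intro n
  refine (Set.finite_singleton a).subset fun i hi => ?_
  by_contra h
  exact hi (by simp only; rw [if_neg (show ¬i = a from h), map_zero])

theorem sum_ite {ι : Type} [DecidableEq ι] (a : ι) (F : Ser) :
    sum (fun i => if i = a then F else 0) = F := by
  rw [sum_eq_single _ a fun i hi => if_neg hi, if_pos rfl]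

/-- The index `k + 1 ≥ 2`. -/
def succIndex (k : ℕ+) : {i : ℕ+ // 2 ≤ i} :=
  ⟨k + 1, by
    have : 1 ≤ k := one_le
    rw [← PNat.coe_le_coe] at this ⊢
    rw [PNat.add_coe]
    exact Nat.succ_le_succ this⟩

/-- The index `k + l ≥ 2`. -/
def addIndex (k l : ℕ+) : {i : ℕ+ // 2 ≤ i} :=
  ⟨k + l, by
    rw [← PNat.coe_le_coe, PNat.add_coe]
    exact Nat.add_le_add k.2 l.2⟩

theorem pnat_eq_sub_one_iff {k : ℕ+} (i : {i : ℕ+ // 2 ≤ i}) :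
    k = i.1 - 1 ↔ i = succIndex k := by
  have h : (1 : ℕ+) < i.1 := lt_of_lt_of_le (by decide) i.2
  rw [Subtype.ext_iff, succIndex]
  constructor
  · rintro rfl
    change i.1 = i.1 - 1 + 1
    rw [add_comm, PNat.add_sub_of_lt h]
  · intro h'
    rw [h', PNat.add_sub]

theorem L_prod_t {ι : Type} [DecidableEq ι] (A : Finset ι) (κ : ι → ℕ+) :
    L (∏ a ∈ A, t (κ a)) =
      ∑ a ∈ A, (κ a : ℕ) • (t (κ a + 1) * ∏ b ∈ A.erase a, t (κ b)) := by
  have h : termL (∏ a ∈ A, t (κ a)) = fun i => ∑ a ∈ A, if i = succIndex (κ a) then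
      (κ a : ℕ) • (t (κ a + 1) * ∏ b ∈ A.erase a, t (κ b)) else 0 := by
    funext i
    rw [termL, dt_prod_t, Finset.mul_sum, Finset.smul_sum]
    refine Finset.sum_congr rfl fun a _ => ?_
    by_cases hi : i = succIndex (κ a)
    · rw [if_pos hi, if_pos ((pnat_eq_sub_one_iff i).2 hi), hi, succIndex,
        ← Nat.cast_smul_eq_nsmul ℚ]
      simp
    · rw [if_neg hi, if_neg fun h' => hi ((pnat_eq_sub_one_iff i).1 h'), mul_zero, smul_zero]
  rw [L, h, sum_finset_sum fun a _ => summable_ite _ _]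
  exact Finset.sum_congr rfl fun a _ => sum_ite _ _

theorem sum_Ico_ite (i : {i : ℕ+ // 2 ≤ i}) (k l : ℕ+) (F : Ser) :
    (∑ j ∈ Finset.Ico 1 i.1, if k = i.1 - j ∧ l = j then F else 0) =
      if i = addIndex k l then F else 0 := by
  split_ifs with h
  · have hl : i.1 - l = k := by rw [h, addIndex, PNat.add_sub]
    rw [Finset.sum_eq_single l]
    · rw [if_pos ⟨hl.symm, rfl⟩]
    · intro j _ hj
      exact if_neg fun h' => hj h'.2.symm
    · intro h'
      refine absurd (Finset.mem_Ico.2 ⟨one_le, ?_⟩) h'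
      rw [h, addIndex]
      exact PNat.lt_add_left l k
  · refine Finset.sum_eq_zero fun j hj => if_neg ?_
    rintro ⟨hk, rfl⟩
    refine h (Subtype.ext ?_)
    change i.1 = k + l
    rw [hk, add_comm, PNat.add_sub_of_lt (Finset.mem_Ico.1 hj).2]

theorem M_prod_t {ι : Type} [DecidableEq ι] (A : Finset ι) (κ : ι → ℕ+) :
    M (∏ a ∈ A, t (κ a)) =
      (∑ a ∈ A, (κ a : ℕ) • ((∑ j ∈ Finset.Ico 1 (κ a + 1), t j * t (κ a + 1 - j)) *
          ∏ b ∈ A.erase a, t (κ b))) +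
        ∑ a ∈ A, ∑ b ∈ A.erase a, ((κ a : ℕ) * (κ b : ℕ)) •
          (t (κ a + κ b + 1) * ∏ c ∈ (A.erase a).erase b, t (κ c)) := by
  have h : termM (∏ a ∈ A, t (κ a)) = fun i =>
      (∑ a ∈ A, if i = succIndex (κ a) then
        (κ a : ℕ) • ((∑ j ∈ Finset.Ico 1 (κ a + 1), t j * t (κ a + 1 - j)) *
          ∏ b ∈ A.erase a, t (κ b)) else 0) +
        ∑ a ∈ A, ∑ b ∈ A.erase a, if i = addIndex (κ a) (κ b) then ((κ a : ℕ) * (κ b : ℕ)) •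
          (t (κ a + κ b + 1) * ∏ c ∈ (A.erase a).erase b, t (κ c)) else 0 := by
    funext i
    rw [termM, Finset.sum_add_distrib]
    congr 1
    · simp only [dt_prod_t, Finset.mul_sum, Finset.smul_sum]
      rw [Finset.sum_comm]
      refine Finset.sum_congr rfl fun a _ => ?_
      by_cases hi : i = succIndex (κ a)
      · rw [if_pos hi, Finset.sum_mul, Finset.smul_sum, hi]
        refine Finset.sum_congr rfl fun j _ => ?_
        rw [if_pos ((pnat_eq_sub_one_iff _).2 rfl), succIndex, ← Nat.cast_smul_eq_nsmul ℚ]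
        simp
      · rw [if_neg hi]
        refine Finset.sum_eq_zero fun j _ => ?_
        rw [if_neg fun h' => hi ((pnat_eq_sub_one_iff i).1 h'), mul_zero, smul_zero]
    · have hdd : ∀ j k, dt j (dt k (∏ a ∈ A, t (κ a))) = ∑ a ∈ A, ∑ b ∈ A.erase a,
          if κ a = k ∧ κ b = j then ∏ c ∈ (A.erase a).erase b, t (κ c) else 0 := by
        intro j k
        rw [dt_prod_t, dt, map_sum]
        refine Finset.sum_congr rfl fun a _ => ?_
        by_cases ha : κ a = k
        · rw [if_pos ha, ← dt, dt_prod_t]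
          simp [ha]
        · rw [if_neg ha, map_zero]
          simp [ha]
      simp only [hdd, Finset.mul_sum, Finset.smul_sum]
      rw [Finset.sum_comm]
      refine Finset.sum_congr rfl fun a _ => ?_
      rw [Finset.sum_comm]
      refine Finset.sum_congr rfl fun b _ => ?_
      rw [← sum_Ico_ite]
      refine Finset.sum_congr rfl fun j hj => ?_
      split_ifs with hab
      · have hi : κ a + κ b = i.1 := by
          rw [hab.1, hab.2, add_comm, PNat.add_sub_of_lt (Finset.mem_Ico.1 hj).2]
        rw [← hi, ← hab.2, ← Nat.cast_smul_eq_nsmul ℚ]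
        congr 1
        push_cast
        ring
      · rw [mul_zero, smul_zero]
  rw [M, h, sum_add, sum_finset_sum fun a _ => summable_ite _ _,
    sum_finset_sum fun a _ => Summable.finset_sum fun b _ => summable_ite _ _]
  · congr 1
    · exact Finset.sum_congr rfl fun a _ => sum_ite _ _
    · refine Finset.sum_congr rfl fun a _ => ?_
      rw [sum_finset_sum fun b _ => summable_ite _ _]
      exact Finset.sum_congr rfl fun b _ => sum_ite _ _
  · exact Summable.finset_sum fun a _ => summable_ite _ _
  · exact Summable.finset_sum fun a _ => Summable.finset_sum fun b _ => summable_ite _ _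

theorem generator_mul_of_dt_eq_zero {c : Ser} (hc : ∀ i, dt i c = 0) (G : Ser) :
    generator (c * G) = c * generator G := by
  have hdt : ∀ i (H : Ser), dt i (c * H) = c * dt i H := fun i H => by
    rw [dt, Derivation.leibniz, ← dt, ← dt, hc, smul_zero, add_zero, smul_eq_mul]
  have hL : L (c * G) = c * L G := by
    rw [L, L, ← sum_mul_left (summable_termL G)]
    refine congrArg sum (funext fun i => ?_)
    rw [termL, termL, hdt, mul_smul_comm, mul_left_comm]
  have hM : M (c * G) = c * M G := by
    rw [M, M, ← sum_mul_left (summable_termM G)]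
    refine congrArg sum (funext fun i => ?_)
    rw [termM, termM, Finset.mul_sum]
    refine Finset.sum_congr rfl fun j _ => ?_
    rw [hdt, hdt, hdt, mul_add, mul_smul_comm, mul_smul_comm, mul_left_comm c, mul_left_comm c]
  rw [generator, generator, hL, hM]
  ring

/-- The variables `tₖ` indexed by natural numbers (with a junk value at `k = 0`). -/
def tn (k : ℕ) : Ser := t k.toPNat'

theorem tn_coe (k : ℕ+) : tn k = t k := by rw [tn, PNat.coe_toPNat']

theorem dt_pow_X_eq_zero {x : Var} (hx : ∀ i, x ≠ Var.t i) (i : ℕ+) (n : ℕ) :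
    dt i ((X x : Ser) ^ n) = 0 := by
  rw [dt, Derivation.leibniz_pow, pderiv_X_of_ne (hx i), smul_zero, smul_zero]

theorem dt_mul_eq_zero {i : ℕ+} {F G : Ser} (hF : dt i F = 0) (hG : dt i G = 0) :
    dt i (F * G) = 0 := by
  rw [dt] at hF hG ⊢
  rw [Derivation.leibniz, hF, hG, smul_zero, smul_zero, add_zero]

end Ser

/-! ### The cut-and-join recursion for pairs of permutations -/

section Recursion

open Equiv Ser

variable {X Y : Type} [Fintype X] [DecidableEq X] [Fintype Y] [DecidableEq Y]

/-- The monomial `s^d u^k v^l t₁^m₁ t₂^m₂ ⋯` of a pair of permutations `α`, `β` of `d` points, where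
`k`, `l` are the numbers of cycles of `α`, `β` and `mᵢ` is the number of cycles of length `i` of
`α β⁻¹`. -/
def pairWeight (α β : Perm X) : Ser :=
  s ^ Fintype.card X * cycleWeight (fun _ => u) α * cycleWeight (fun _ => v) β *
    cycleWeight tn (α * β⁻¹)

/-- The sum of the monomials of all pairs of permutations of a finite set. -/
def pairSum (X : Type) [Fintype X] [DecidableEq X] : Ser :=
  ∑ α : Perm X, ∑ β : Perm X, pairWeight α β

theorem cycleWeight_conj {R : Type} [CommRing R] (x : ℕ → R) (τ γ : Perm X) :
    cycleWeight x (τ * γ * τ⁻¹) = cycleWeight x γ :=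
  cycleWeight_permCongr τ γ x

theorem generator_cycleWeight (γ : Perm X) :
    generator (cycleWeight tn γ) = s * ((u + v) *
        ∑ i, cycleWeight tn (swap none (some i) * optionCongr γ) +
      ∑ j, ∑ i, cycleWeight tn (swap none (some i) * (swap none (some j) * optionCongr γ)) +
      u * v * cycleWeight tn (optionCongr γ)) := by
  set κ : Finset X → ℕ+ := fun O => O.card.toPNat'
  have hκ : ∀ O ∈ cycles γ, (κ O : ℕ) = O.card := fun O hO => by
    rw [Nat.toPNat'_coe, if_pos (card_pos_of_mem_cycles hO)]
  have hP : cycleWeight tn γ = ∏ O ∈ cycles γ, t (κ O) := rfl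
  have hL : L (cycleWeight tn γ) =
      ∑ i, cycleWeight tn (swap none (some i) * optionCongr γ) := by
    rw [hP, L_prod_t, sum_cycleWeight_insert]
    refine Finset.sum_congr rfl fun O hO => ?_
    rw [hκ O hO, ← hκ O hO, ← PNat.one_coe, ← PNat.add_coe, tn_coe]
    rfl
  have hM : M (cycleWeight tn γ) =
      ∑ j, ∑ i, cycleWeight tn (swap none (some i) * (swap none (some j) * optionCongr γ)) := by
    rw [hP, M_prod_t, sum_cycleWeight_insert_swap, ← Finset.sum_add_distrib]
    refine Finset.sum_congr rfl fun O hO => ?_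
    rw [smul_add, Finset.smul_sum, ← hκ O hO]
    congr 1
    · congr 2
      refine Finset.sum_bij (fun j _ => (j : ℕ)) ?_ ?_ ?_ ?_
      · intro j hj
        rw [Finset.mem_Ico, ← PNat.coe_lt_coe] at hj
        exact Finset.mem_Ico.2 ⟨(j.2 : 1 ≤ (j : ℕ)), by simpa using hj.2⟩
      · intro j _ j' _ h
        exact PNat.eq h
      · intro n hn
        rw [Finset.mem_Ico] at hn
        obtain ⟨m, rfl⟩ : ∃ m : ℕ+, (m : ℕ) = n := ⟨⟨n, hn.1⟩, rfl⟩
        refine ⟨m, ?_, rfl⟩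
        rw [Finset.mem_Ico, ← PNat.coe_lt_coe]
        exact ⟨one_le, by simpa using hn.2⟩
      · intro j hj
        have hlt := (Finset.mem_Ico.1 hj).2
        rw [tn_coe, ← tn_coe (κ O + 1 - j), PNat.sub_coe, if_pos hlt]
        rfl
    · refine Finset.sum_congr rfl fun O' hO' => ?_
      rw [← hκ O' (Finset.mem_of_mem_erase hO'), smul_smul, add_right_comm (κ O : ℕ),
        ← PNat.add_coe, ← PNat.one_coe, ← PNat.add_coe, tn_coe]
      rfl
  have ht : tn 1 = t 1 := tn_coe 1
  rw [generator, hL, hM, cycleWeight_optionCongr, ht, mul_assoc (u * v)]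

/-- Adding a point to the set of `d` points amounts to applying the operator
`s((u + v)L₁ + M₁ + u v t₁)`. -/
theorem pairSum_option : pairSum (Option X) = generator (pairSum X) := by
  have hsum : ∀ f : Perm (Option X) → Ser, ∑ α, f α =
      ∑ a : Perm X, (f (optionCongr a) + ∑ i, f (swap none (some i) * optionCongr a)) := by
    intro f
    rw [← Equiv.sum_comp Perm.decomposeOption.symm, Fintype.sum_prod_type_right]
    refine Finset.sum_congr rfl fun a _ => ?_
    rw [Fintype.sum_option]
    simp [Perm.decomposeOption, ← Perm.one_def]
  rw [pairSum, hsum]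
  simp only [hsum]
  rw [pairSum, generator_sum]
  refine Finset.sum_congr rfl fun a _ => ?_
  rw [generator_sum, Finset.sum_comm, ← Finset.sum_add_distrib]
  refine Finset.sum_congr rfl fun b _ => ?_
  set c : Ser := s ^ Fintype.card X * cycleWeight (fun _ => u) a * cycleWeight (fun _ => v) b
    with hc
  have hdc : ∀ i, dt i c = 0 := by
    intro i
    have h1 : dt i (s ^ Fintype.card X) = 0 := dt_pow_X_eq_zero (x := Var.s) (by simp) i (Fintype.card X)
    have h2 : dt i (u ^ (cycles a).card) = 0 := dt_pow_X_eq_zero (x := Var.u) (by simp) i (cycles a).card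
    have h3 : dt i (v ^ (cycles b).card) = 0 := dt_pow_X_eq_zero (x := Var.v) (by simp) i (cycles b).card
    rw [hc, cycleWeight, cycleWeight, Finset.prod_const, Finset.prod_const]
    exact dt_mul_eq_zero (dt_mul_eq_zero h1 h2) h3
  have hinv : ∀ b : Perm X, (optionCongr b : Perm (Option X))⁻¹ = optionCongr b⁻¹ := fun b => rfl
  have hmul : (optionCongr a : Perm (Option X)) * (optionCongr b⁻¹ : Perm (Option X)) =
      optionCongr (a * b⁻¹) := by
    ext x
    cases x <;> rfl
  -- the product `α β⁻¹` for the four kinds of pairs of permutations of the enlarged set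
  have e1 : pairWeight (optionCongr a) (optionCongr b) =
      s * (u * v) * c * cycleWeight tn (optionCongr (a * b⁻¹)) := by
    rw [pairWeight, hinv, hmul, cycleWeight_optionCongr, cycleWeight_optionCongr,
      Fintype.card_option, pow_succ, hc]
    ring
  have e2 : ∀ i, pairWeight (swap none (some i) * optionCongr a) (optionCongr b) =
      s * v * c * cycleWeight tn (swap none (some i) * optionCongr (a * b⁻¹)) := fun i => by
    rw [pairWeight, hinv, mul_assoc (swap none (some i)), hmul, cycleWeight_const_insert,
      cycleWeight_optionCongr, Fintype.card_option, pow_succ, hc]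
    ring
  have e3 : ∀ j, pairWeight (optionCongr a) (swap none (some j) * optionCongr b) =
      s * u * c * cycleWeight tn (swap none (some j) * optionCongr (a * b⁻¹)) := fun j => by
    rw [pairWeight, mul_inv_rev, hinv, ← mul_assoc (optionCongr a : Perm (Option X)), hmul,
      ← cycleWeight_conj tn (swap none (some j)), swap_inv, mul_assoc (swap none (some j)),
      mul_assoc (optionCongr (a * b⁻¹) : Perm (Option X)), swap_mul_self, mul_one,
      cycleWeight_const_insert, cycleWeight_optionCongr, Fintype.card_option, pow_succ, hc]
    ring
  have e4 : ∀ i j, pairWeight (swap none (some i) * optionCongr a)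
      (swap none (some j) * optionCongr b) = s * c *
        cycleWeight tn (swap none (some j) * (swap none (some i) * optionCongr (a * b⁻¹))) :=
    fun i j => by
    rw [pairWeight, mul_inv_rev, hinv, mul_assoc (swap none (some i)),
      ← mul_assoc (optionCongr a : Perm (Option X)), hmul,
      ← cycleWeight_conj tn (swap none (some j)), swap_inv, mul_assoc (swap none (some j)),
      mul_assoc (swap none (some i)), mul_assoc (optionCongr (a * b⁻¹) : Perm (Option X)),
      swap_mul_self, mul_one, cycleWeight_const_insert, cycleWeight_const_insert,
      Fintype.card_option, pow_succ, hc]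
    ring
  simp only [e1, e2, e3, e4, ← Finset.mul_sum]
  rw [pairWeight, ← hc, generator_mul_of_dt_eq_zero hdc, generator_cycleWeight]
  simp only [Finset.sum_add_distrib, ← Finset.mul_sum]
  ring

theorem pairWeight_permCongr (e : X ≃ Y) (α β : Perm X) :
    pairWeight (e.permCongr α) (e.permCongr β) = pairWeight α β := by
  have h : e.permCongr α * (e.permCongr β)⁻¹ = e.permCongr (α * β⁻¹) := by
    rw [mul_inv_eq_iff_eq_mul]
    ext y
    simp [Perm.mul_apply]
  rw [pairWeight, h, cycleWeight_permCongr, cycleWeight_permCongr, cycleWeight_permCongr,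
    ← Fintype.card_congr e, pairWeight]

theorem pairSum_congr (e : X ≃ Y) : pairSum X = pairSum Y := by
  rw [pairSum, pairSum, ← Equiv.sum_comp e.permCongr]
  refine Finset.sum_congr rfl fun α _ => ?_
  rw [← Equiv.sum_comp e.permCongr]
  exact Finset.sum_congr rfl fun β _ => (pairWeight_permCongr e α β).symm

theorem pairSum_fin (d : ℕ) : pairSum (Fin d) = generator^[d] 1 := by
  induction d with
  | zero =>
    rw [pairSum, Fintype.sum_unique, Fintype.sum_unique, pairWeight]
    simp [cycleWeight, cycles]
  | succ d ih =>
    rw [Function.iterate_succ_apply', ← ih, ← pairSum_option]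
    exact pairSum_congr finSuccEquivLast

end Recursion

/-! ### Transitive pairs of permutations and the exponential formula -/

section Transitive

open Equiv Ser

variable {X Y : Type}

/-- Two points are joined by a pair of permutations if they lie in one orbit of the group that the
pair generates. -/
def JoinedBy (α β : Perm X) : X → X → Prop := Relation.EqvGen fun x y => y = α x ∨ y = β x

/-- The group generated by the pair of permutations acts transitively on a nonempty set. -/
def IsTransPair (α β : Perm X) : Prop := Nonempty X ∧ ∀ x y, JoinedBy α β x y

theorem JoinedBy.map {a b : Perm X} {α β : Perm Y} (f : X → Y) (hα : ∀ x, α (f x) = f (a x))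
    (hβ : ∀ x, β (f x) = f (b x)) {x y : X} (h : JoinedBy a b x y) : JoinedBy α β (f x) (f y) := by
  induction h with
  | rel x y h =>
    rcases h with rfl | rfl
    · exact .rel _ _ (.inl (hα x).symm)
    · exact .rel _ _ (.inr (hβ x).symm)
  | refl x => exact .refl _
  | symm x y _ ih => exact .symm _ _ ih
  | trans x y z _ _ ih1 ih2 => exact .trans _ _ _ ih1 ih2

theorem JoinedBy.iff_of_invariant {α β : Perm Y} {P : Y → Prop} (hα : ∀ y, P (α y) ↔ P y)
    (hβ : ∀ y, P (β y) ↔ P y) {x y : Y} (h : JoinedBy α β x y) : P x ↔ P y := by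
  induction h with
  | rel x y h =>
    rcases h with rfl | rfl
    · exact (hα x).symm
    · exact (hβ x).symm
  | refl x => exact Iff.rfl
  | symm x y _ ih => exact ih.symm
  | trans x y z _ _ ih1 ih2 => exact ih1.trans ih2

theorem JoinedBy.restrict {α β : Perm Y} {P : Y → Prop} (hα : ∀ y, P (α y) ↔ P y)
    (hβ : ∀ y, P (β y) ↔ P y) {x y : Y} (h : JoinedBy α β x y) (hx : P x) (hy : P y) :
    JoinedBy (α.subtypePerm hα) (β.subtypePerm hβ) ⟨x, hx⟩ ⟨y, hy⟩ := by
  induction h with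
  | rel x y h =>
    rcases h with rfl | rfl
    · exact .rel _ _ (.inl rfl)
    · exact .rel _ _ (.inr rfl)
  | refl x => exact .refl _
  | symm x y _ ih => exact .symm _ _ (ih hy hx)
  | trans x y z h1 h2 ih1 ih2 =>
    have hy' := (JoinedBy.iff_of_invariant hα hβ h1).1 hx
    exact .trans _ _ _ (ih1 hx hy') (ih2 hy' hy)

theorem IsTransPair.map (e : X ≃ Y) {α β : Perm X} (h : IsTransPair α β) :
    IsTransPair (e.permCongr α) (e.permCongr β) := by
  refine ⟨h.1.map e, fun x y => ?_⟩
  have := (h.2 (e.symm x) (e.symm y)).map (α := e.permCongr α) (β := e.permCongr β) e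
    (by simp) (by simp)
  simpa using this

theorem isTransPair_permCongr (e : X ≃ Y) (α β : Perm X) :
    IsTransPair (e.permCongr α) (e.permCongr β) ↔ IsTransPair α β := by
  refine ⟨fun h => ?_, fun h => h.map e⟩
  have := h.map e.symm
  have h1 : ∀ γ : Perm X, e.symm.permCongr (e.permCongr γ) = γ := fun γ => by
    ext x
    simp
  rwa [h1, h1] at this

theorem mem_compl_orbit_iff {α β : Perm Y} {p : Y} {U : Finset Y}
    (hU : ∀ y, y ∈ U ↔ ¬JoinedBy α β p y) :
    (∀ y, α y ∈ U ↔ y ∈ U) ∧ ∀ y, β y ∈ U ↔ y ∈ U := by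
  refine ⟨fun y => ?_, fun y => ?_⟩ <;> rw [hU, hU, not_iff_not]
  · exact ⟨fun h => h.trans _ _ _ (.symm _ _ (.rel _ _ (.inl rfl))),
      fun h => h.trans _ _ _ (.rel _ _ (.inl rfl))⟩
  · exact ⟨fun h => h.trans _ _ _ (.symm _ _ (.rel _ _ (.inr rfl))),
      fun h => h.trans _ _ _ (.rel _ _ (.inr rfl))⟩

variable [Fintype X] [DecidableEq X] [Fintype Y] [DecidableEq Y]

open Classical in
/-- The sum of the monomials of all transitive pairs of permutations of a finite set. -/
def transPairSum (X : Type) [Fintype X] [DecidableEq X] : Ser :=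
  ∑ π : Perm X × Perm X with IsTransPair π.1 π.2, pairWeight π.1 π.2

theorem pairSum_eq_sum_prod : pairSum X = ∑ π : Perm X × Perm X, pairWeight π.1 π.2 :=
  (Fintype.sum_prod_type' fun α β : Perm X => pairWeight α β).symm

theorem transPairSum_congr (e : X ≃ Y) : transPairSum X = transPairSum Y := by
  classical
  rw [transPairSum, transPairSum]
  refine Finset.sum_equiv (e.permCongr.prodCongr e.permCongr) ?_ ?_
  · intro π
    simp only [Finset.mem_filter, Finset.mem_univ, true_and]
    exact (isTransPair_permCongr e π.1 π.2).symm
  · intro π _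
    exact (pairWeight_permCongr e π.1 π.2).symm

/-- The cycles of a permutation preserving a subset are the cycles inside and the cycles outside
this subset. -/
theorem cycleWeight_subtypeCongr {R : Type} [CommRing R] (x : ℕ → R) (P : Y → Prop)
    [DecidablePred P] [Fintype {y // P y}] [Fintype {y // ¬P y}] (a : Perm {y // P y}) (b : Perm {y // ¬P y}) :
    cycleWeight x (a.subtypeCongr b) = cycleWeight x a * cycleWeight x b := by
  have ha : ∀ y, cyc (a.subtypeCongr b) (Function.Embedding.subtype P y) =
      (cyc a y).map (Function.Embedding.subtype P) :=
    cyc_map _ fun y => Perm.subtypeCongr.left_apply_subtype a b y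
  have hb : ∀ y, cyc (a.subtypeCongr b) (Function.Embedding.subtype (¬P ·) y) =
      (cyc b y).map (Function.Embedding.subtype (¬P ·)) :=
    cyc_map _ fun y => Perm.subtypeCongr.right_apply_subtype a b y
  have h : cycles (a.subtypeCongr b) =
      (cycles a).image (Finset.map (Function.Embedding.subtype P)) ∪
        (cycles b).image (Finset.map (Function.Embedding.subtype (¬P ·))) := by
    ext O
    rw [mem_cycles, Finset.mem_union, Finset.mem_image, Finset.mem_image]
    constructor
    · rintro ⟨y, rfl⟩
      by_cases hy : P y
      · exact .inl ⟨_, cyc_mem_cycles a ⟨y, hy⟩, (ha ⟨y, hy⟩).symm⟩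
      · exact .inr ⟨_, cyc_mem_cycles b ⟨y, hy⟩, (hb ⟨y, hy⟩).symm⟩
    · rintro (⟨O', hO', rfl⟩ | ⟨O', hO', rfl⟩)
      · obtain ⟨y, rfl⟩ := mem_cycles.1 hO'
        exact ⟨_, ha y⟩
      · obtain ⟨y, rfl⟩ := mem_cycles.1 hO'
        exact ⟨_, hb y⟩
  rw [cycleWeight, h, Finset.prod_union, prod_image_map, prod_image_map, cycleWeight, cycleWeight]
  rw [Finset.disjoint_left]
  intro O h1 h2
  obtain ⟨O1, hO1, rfl⟩ := Finset.mem_image.1 h1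
  obtain ⟨O2, hO2, h3⟩ := Finset.mem_image.1 h2
  obtain ⟨y, hy⟩ := Finset.card_pos.1 (card_pos_of_mem_cycles hO1)
  have h4 := Finset.mem_map_of_mem (Function.Embedding.subtype P) hy
  rw [← h3] at h4
  obtain ⟨z, _, hz⟩ := Finset.mem_map.1 h4
  exact z.2 (by
    have : (z : Y) = y := hz
    rw [this]
    exact y.2)

theorem pairWeight_subtypeCongr (P : Y → Prop) [DecidablePred P] [Fintype {y // P y}]
    [Fintype {y // ¬P y}] (a a' : Perm {y // P y}) (b b' : Perm {y // ¬P y}) :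
    pairWeight (a.subtypeCongr b) (a'.subtypeCongr b') = pairWeight a a' * pairWeight b b' := by
  have h : a.subtypeCongr b * (a'.subtypeCongr b')⁻¹ = (a * a'⁻¹).subtypeCongr (b * b'⁻¹) := by
    have h1 := map_mul (Perm.subtypeCongrHom P) (a, b) ((a', b')⁻¹)
    rw [map_inv] at h1
    exact h1.symm
  have hcard : Fintype.card Y = Fintype.card {y // P y} + Fintype.card {y // ¬P y} := by
    rw [← Fintype.card_sum]
    exact (Fintype.card_congr (Equiv.sumCompl P)).symm
  rw [pairWeight, h, cycleWeight_subtypeCongr, cycleWeight_subtypeCongr, cycleWeight_subtypeCongr,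
    hcard, pow_add, pairWeight, pairWeight]
  ring

open Classical in
/-- The pairs for which the orbit of `p` is the complement of `U` consist of an arbitrary pair on
`U` and a transitive pair on the complement. -/
theorem sum_pairWeight_of_orbit (p : Y) (U : Finset Y) (hp : p ∉ U) :
    ∑ π : Perm Y × Perm Y with (Finset.univ.filter fun y => ¬JoinedBy π.1 π.2 p y) = U,
        pairWeight π.1 π.2 =
      pairSum {y // y ∈ U} * transPairSum {y // y ∉ U} := by
  rw [pairSum_eq_sum_prod, transPairSum, Finset.sum_mul_sum, ← Finset.sum_product']
  symm
  refine Finset.sum_bij (fun q _ => (q.1.1.subtypeCongr q.2.1, q.1.2.subtypeCongr q.2.2))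
    ?_ ?_ ?_ ?_
  · rintro ⟨⟨a, a'⟩, b, b'⟩ hq
    have hb : IsTransPair b b' := by simpa using hq
    have hinv : ∀ (c : Perm {y // y ∈ U}) (c' : Perm {y // y ∉ U}) (y : Y),
        c.subtypeCongr c' y ∈ U ↔ y ∈ U := by
      intro c c' y
      by_cases hy : y ∈ U
      · rw [Perm.subtypeCongr.left_apply c c' hy]
        exact ⟨fun _ => hy, fun _ => (c ⟨y, hy⟩).2⟩
      · rw [Perm.subtypeCongr.right_apply c c' hy]
        exact ⟨fun h => absurd h (c' ⟨y, hy⟩).2, fun h => absurd h hy⟩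
    rw [Finset.mem_filter]
    refine ⟨Finset.mem_univ _, ?_⟩
    ext y
    simp only [Finset.mem_filter, Finset.mem_univ, true_and]
    constructor
    · intro h
      by_contra hy
      exact h ((hb.2 ⟨p, hp⟩ ⟨y, hy⟩).map Subtype.val
        (Perm.subtypeCongr.right_apply_subtype a b) (Perm.subtypeCongr.right_apply_subtype a' b'))
    · intro hy h
      exact hp ((JoinedBy.iff_of_invariant (P := (· ∈ U)) (hinv a b) (hinv a' b') h).2 hy)
  · rintro ⟨⟨a, a'⟩, b, b'⟩ _ ⟨⟨c, c'⟩, d, d'⟩ _ h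
    simp only [Prod.mk.injEq] at h
    have h1 := Perm.subtypeCongrHom_injective (· ∈ U) (a₁ := (a, b)) (a₂ := (c, d)) h.1
    have h2 := Perm.subtypeCongrHom_injective (· ∈ U) (a₁ := (a', b')) (a₂ := (c', d')) h.2
    simp only [Prod.mk.injEq] at h1 h2 ⊢
    exact ⟨⟨h1.1, h2.1⟩, h1.2, h2.2⟩
  · rintro ⟨α, β⟩ hπ
    have hU : ∀ y, y ∈ U ↔ ¬JoinedBy α β p y := fun y => by
      rw [← (Finset.mem_filter.1 hπ).2]
      simp
    obtain ⟨hα, hβ⟩ := mem_compl_orbit_iff hU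
    have hα' : ∀ y, α y ∉ U ↔ y ∉ U := fun y => not_congr (hα y)
    have hβ' : ∀ y, β y ∉ U ↔ y ∉ U := fun y => not_congr (hβ y)
    have hglue : ∀ (γ : Perm Y) (h : ∀ y, γ y ∈ U ↔ y ∈ U) (h' : ∀ y, γ y ∉ U ↔ y ∉ U),
        (γ.subtypePerm h).subtypeCongr (γ.subtypePerm h') = γ := by
      intro γ h h'
      ext y
      by_cases hy : y ∈ U
      · rw [Perm.subtypeCongr.left_apply _ _ hy]
        rfl
      · rw [Perm.subtypeCongr.right_apply _ _ hy]
        rfl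
    refine ⟨((α.subtypePerm hα, β.subtypePerm hβ), α.subtypePerm hα', β.subtypePerm hβ'), ?_, ?_⟩
    · simp only [Finset.mem_product, Finset.mem_univ, Finset.mem_filter, true_and]
      refine ⟨⟨⟨p, hp⟩⟩, fun x y => JoinedBy.restrict (P := (· ∉ U)) hα' hβ' ?_ x.2 y.2⟩
      have hx := not_not.1 (mt (hU x).2 x.2)
      have hy := not_not.1 (mt (hU y).2 y.2)
      exact .trans _ _ _ (.symm _ _ hx) hy
    · exact Prod.ext (hglue α hα hα') (hglue β hβ hβ')
  · rintro ⟨⟨a, a'⟩, b, b'⟩ _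
    exact (pairWeight_subtypeCongr _ a a' b b').symm

/-- A pair of permutations of a pointed set is a transitive pair on the orbit of the distinguished
point together with a pair of permutations of the complement of this orbit. -/
theorem pairSum_fin_succ (d : ℕ) : pairSum (Fin (d + 1)) =
    ∑ a ∈ Finset.range (d + 1),
      d.choose a • (pairSum (Fin a) * transPairSum (Fin (d + 1 - a))) := by
  classical
  have hcard : ((Finset.univ : Finset (Fin (d + 1))).erase 0).card = d := by simp
  have h := Finset.sum_powerset_apply_card (x := (Finset.univ : Finset (Fin (d + 1))).erase 0)
    fun a => pairSum (Fin a) * transPairSum (Fin (d + 1 - a))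
  rw [hcard] at h
  rw [← h, pairSum_eq_sum_prod, ← Finset.sum_fiberwise_of_maps_to
    (t := ((Finset.univ : Finset (Fin (d + 1))).erase 0).powerset)
    (g := fun π => Finset.univ.filter fun y => ¬JoinedBy π.1 π.2 0 y)]
  · refine Finset.sum_congr rfl fun U hU => ?_
    have h0 : (0 : Fin (d + 1)) ∉ U := fun h' =>
      Finset.notMem_erase _ _ (Finset.mem_powerset.1 hU h')
    rw [sum_pairWeight_of_orbit 0 U h0]
    congr 1
    · exact pairSum_congr (Fintype.equivFinOfCardEq (by simp))
    · exact transPairSum_congr (Fintype.equivFinOfCardEq (by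
        rw [Fintype.card_subtype_compl]
        simp))
  · intro π _
    rw [Finset.mem_powerset]
    intro y hy
    rw [Finset.mem_erase]
    refine ⟨?_, Finset.mem_univ _⟩
    rintro rfl
    exact (Finset.mem_filter.1 hy).2 (.refl _)

end Transitive

/-! ### The pair of permutations of a Belyi graph -/

namespace BelyiGraph

open Equiv

variable {W B E W' B' E' : Type}

/-- An edge is determined by its white vertex and its colour. -/
def edgeEquivWhite (Γ : BelyiGraph W B E) : E ≃ W × EdgeColour :=
  Equiv.ofBijective _ Γ.white_colour_bijective

/-- An edge is determined by its black vertex and its colour. -/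
def edgeEquivBlack (Γ : BelyiGraph W B E) : E ≃ B × EdgeColour :=
  Equiv.ofBijective _ Γ.black_colour_bijective

theorem edgeEquivWhite_apply (Γ : BelyiGraph W B E) (e : E) :
    Γ.edgeEquivWhite e = (Γ.white e, Γ.colour e) := rfl

theorem edgeEquivBlack_apply (Γ : BelyiGraph W B E) (e : E) :
    Γ.edgeEquivBlack e = (Γ.black e, Γ.colour e) := rfl

/-- The bijection from white to black vertices given by the edges of one colour. -/
def matching (Γ : BelyiGraph W B E) (c : EdgeColour) : W ≃ B where
  toFun w := Γ.black (Γ.edgeEquivWhite.symm (w, c))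
  invFun b := Γ.white (Γ.edgeEquivBlack.symm (b, c))
  left_inv w := by
    obtain ⟨e, he⟩ := Γ.edgeEquivWhite.surjective (w, c)
    simp only [← he, Equiv.symm_apply_apply]
    obtain ⟨rfl, rfl⟩ := Prod.mk.inj he
    rw [← edgeEquivBlack_apply, Equiv.symm_apply_apply]
  right_inv b := by
    obtain ⟨e, he⟩ := Γ.edgeEquivBlack.surjective (b, c)
    simp only [← he, Equiv.symm_apply_apply]
    obtain ⟨rfl, rfl⟩ := Prod.mk.inj he
    rw [← edgeEquivWhite_apply, Equiv.symm_apply_apply]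

theorem matching_white (Γ : BelyiGraph W B E) (e : E) :
    Γ.matching (Γ.colour e) (Γ.white e) = Γ.black e := by
  change Γ.black (Γ.edgeEquivWhite.symm (Γ.edgeEquivWhite e)) = _
  rw [Equiv.symm_apply_apply]

theorem exists_edge (Γ : BelyiGraph W B E) (c : EdgeColour) (w : W) :
    ∃ e, Γ.colour e = c ∧ Γ.white e = w ∧ Γ.black e = Γ.matching c w := by
  obtain ⟨e, he⟩ := Γ.edgeEquivWhite.surjective (w, c)
  obtain ⟨rfl, rfl⟩ := Prod.mk.inj he
  exact ⟨e, rfl, rfl, (Γ.matching_white e).symm⟩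

/-- The permutation of the white vertices that goes along an edge of colour `a` and back along an
edge of colour `b`. -/
def turn (Γ : BelyiGraph W B E) (a b : EdgeColour) : Perm W :=
  (Γ.matching a).trans (Γ.matching b).symm

theorem matching_turn (Γ : BelyiGraph W B E) (a b : EdgeColour) (w : W) :
    Γ.matching b (Γ.turn a b w) = Γ.matching a w := by
  simp [turn]

theorem bicolouredGraph_adj (Γ : BelyiGraph W B E) (a b c : EdgeColour) (hc : c = a ∨ c = b)
    (w : W) : (Γ.bicolouredGraph a b).Adj (Sum.inl w) (Sum.inr (Γ.matching c w)) := by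
  obtain ⟨e, rfl, rfl, he⟩ := Γ.exists_edge c w
  rw [bicolouredGraph, SimpleGraph.fromRel_adj]
  exact ⟨by simp, .inl ⟨e, hc, rfl, by rw [he]⟩⟩

section Components

theorem reachable_of_sameCycle [Finite W] (Γ : BelyiGraph W B E) {a b : EdgeColour} {w w' : W}
    (h : (Γ.turn a b).SameCycle w w') :
    (Γ.bicolouredGraph a b).Reachable (.inl w) (.inl w') := by
  obtain ⟨n, rfl⟩ := h.exists_nat_pow_eq
  clear h
  induction n with
  | zero => rfl
  | succ n ih =>
    rw [pow_succ', Perm.mul_apply]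
    refine ih.trans ?_
    have h1 := Γ.bicolouredGraph_adj a b a (.inl rfl) ((Γ.turn a b ^ n) w)
    have h2 := Γ.bicolouredGraph_adj a b b (.inr rfl) (Γ.turn a b ((Γ.turn a b ^ n) w))
    rw [matching_turn] at h2
    exact h1.reachable.trans h2.reachable.symm

theorem exists_white_rep (Γ : BelyiGraph W B E) {a b : EdgeColour} (C : Γ.Cycle a b) :
    ∃ w, (Γ.bicolouredGraph a b).connectedComponentMk (.inl w) = C := by
  induction C using SimpleGraph.ConnectedComponent.ind with
  | h x =>
    rcases x with w | x
    · exact ⟨w, rfl⟩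
    · refine ⟨(Γ.matching b).symm x, SimpleGraph.ConnectedComponent.sound ?_⟩
      have h := Γ.bicolouredGraph_adj a b b (.inr rfl) ((Γ.matching b).symm x)
      rw [Equiv.apply_symm_apply] at h
      exact h.reachable

variable [Fintype W] [DecidableEq W]

/-- The cycle of `turn a b` (a set of white vertices) to which a vertex belongs. -/
def vertexCycle (Γ : BelyiGraph W B E) (a b : EdgeColour) : W ⊕ B → Finset W :=
  Sum.elim (cyc (Γ.turn a b)) fun x => cyc (Γ.turn a b) ((Γ.matching b).symm x)

theorem vertexCycle_eq_of_adj (Γ : BelyiGraph W B E) {a b : EdgeColour} {x y : W ⊕ B}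
    (h : (Γ.bicolouredGraph a b).Adj x y) : Γ.vertexCycle a b x = Γ.vertexCycle a b y := by
  have key : ∀ e, (Γ.colour e = a ∨ Γ.colour e = b) →
      Γ.vertexCycle a b (.inl (Γ.white e)) = Γ.vertexCycle a b (.inr (Γ.black e)) := by
    intro e he
    change cyc _ _ = cyc _ _
    rw [cyc_eq_cyc_iff, ← matching_white]
    rcases he with he | he
    · rw [he]
      exact Perm.SameCycle.apply_right (Perm.SameCycle.refl (Γ.turn a b) _)
    · rw [he, Equiv.symm_apply_apply]
  rw [bicolouredGraph, SimpleGraph.fromRel_adj] at h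
  rcases h.2 with ⟨e, he, rfl, rfl⟩ | ⟨e, he, rfl, rfl⟩
  · exact key e he
  · exact (key e he).symm

theorem vertexCycle_eq_of_reachable (Γ : BelyiGraph W B E) {a b : EdgeColour} {x y : W ⊕ B}
    (h : (Γ.bicolouredGraph a b).Reachable x y) :
    Γ.vertexCycle a b x = Γ.vertexCycle a b y := by
  obtain ⟨p⟩ := h
  induction p with
  | nil => rfl
  | cons h _ ih => exact (Γ.vertexCycle_eq_of_adj h).trans ih

/-- The set of white vertices of an `a`-`b` cycle, which is a cycle of the permutation
`turn a b`. -/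
def cycleWhite (Γ : BelyiGraph W B E) {a b : EdgeColour} (C : Γ.Cycle a b) : Finset W :=
  C.lift (Γ.vertexCycle a b) fun _ _ p _ => Γ.vertexCycle_eq_of_reachable ⟨p⟩

theorem cycleWhite_mk (Γ : BelyiGraph W B E) {a b : EdgeColour} (w : W) :
    Γ.cycleWhite ((Γ.bicolouredGraph a b).connectedComponentMk (.inl w)) =
      cyc (Γ.turn a b) w := rfl

theorem mk_eq_iff (Γ : BelyiGraph W B E) {a b : EdgeColour} (C : Γ.Cycle a b) (w : W) :
    (Γ.bicolouredGraph a b).connectedComponentMk (.inl w) = C ↔ w ∈ Γ.cycleWhite C := by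
  constructor
  · rintro rfl
    exact self_mem_cyc _ _
  · intro h
    obtain ⟨w', rfl⟩ := Γ.exists_white_rep C
    rw [cycleWhite_mk, mem_cyc] at h
    exact SimpleGraph.ConnectedComponent.sound (Γ.reachable_of_sameCycle h.symm)

/-- The `a`-`b` cycles of a Belyi graph are the cycles of the permutation `turn a b`. -/
def cycleEquiv (Γ : BelyiGraph W B E) (a b : EdgeColour) :
    Γ.Cycle a b ≃ {O // O ∈ cycles (Γ.turn a b)} :=
  Equiv.ofBijective (fun C => ⟨Γ.cycleWhite C, by
      obtain ⟨w, rfl⟩ := Γ.exists_white_rep C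
      exact cyc_mem_cycles _ w⟩) (by
    constructor
    · intro C C' h
      obtain ⟨w, rfl⟩ := Γ.exists_white_rep C
      have h' : cyc (Γ.turn a b) w = Γ.cycleWhite C' := congrArg Subtype.val h
      rw [mk_eq_iff, ← h']
      exact self_mem_cyc _ _
    · rintro ⟨O, hO⟩
      obtain ⟨w, rfl⟩ := mem_cycles.1 hO
      exact ⟨(Γ.bicolouredGraph a b).connectedComponentMk (.inl w), rfl⟩)

theorem card_cycle (Γ : BelyiGraph W B E) (a b : EdgeColour) :
    Nat.card (Γ.Cycle a b) = (cycles (Γ.turn a b)).card := by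
  rw [Nat.card_congr (Γ.cycleEquiv a b)]
  simp

theorem cycle_length (Γ : BelyiGraph W B E) {a b : EdgeColour} (hab : a ≠ b) (C : Γ.Cycle a b) :
    C.length = 2 * (Γ.cycleWhite C).card := by
  have h : {e : E | (Γ.colour e = a ∨ Γ.colour e = b) ∧
      (Γ.bicolouredGraph a b).connectedComponentMk (Sum.inl (Γ.white e)) = C} =
      Γ.edgeEquivWhite ⁻¹' ((Γ.cycleWhite C : Set W) ×ˢ {a, b}) := by
    ext e
    simp only [Set.mem_ofPred_eq, Set.mem_preimage, edgeEquivWhite_apply, Set.mem_prod,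
      Finset.mem_coe, Set.mem_insert_iff, Set.mem_singleton_iff, mk_eq_iff]
    exact and_comm
  rw [Cycle.length, h, Set.ncard_preimage_of_injective_subset_range Γ.edgeEquivWhite.injective
    (by simp), Set.ncard_prod, Set.ncard_coe_finset, Set.ncard_pair hab, mul_comm]

theorem card_cycle_length (Γ : BelyiGraph W B E) {a b : EdgeColour} (hab : a ≠ b) (k : ℕ) :
    Nat.card {C : Γ.Cycle a b // C.length = 2 * k} =
      ((cycles (Γ.turn a b)).filter fun O => O.card = k).card := by
  have h : {C : Γ.Cycle a b // C.length = 2 * k} ≃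
      {O : {O // O ∈ cycles (Γ.turn a b)} // O.1.card = k} :=
    (Γ.cycleEquiv a b).subtypeEquiv fun C => by
      rw [cycle_length Γ hab]
      change _ ↔ (Γ.cycleWhite C).card = k
      omega
  rw [Nat.card_congr (h.trans (Equiv.subtypeSubtypeEquivSubtypeInter
    (fun O => O ∈ cycles (Γ.turn a b)) fun O => O.card = k))]
  rw [Nat.card_eq_fintype_card, Fintype.card_subtype]
  congr 1
  ext O
  simp

end Components

/-! ### Belyi graphs and transitive pairs of permutations -/

/-- The pair of permutations of the white vertices whose cycles are the red-green and the blue-green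
cycles. -/
def perms (Γ : BelyiGraph W B E) : Perm W × Perm W := (Γ.turn .red .green, Γ.turn .blue .green)

theorem isTransPair_perms (Γ : BelyiGraph W B E) : IsTransPair Γ.perms.1 Γ.perms.2 := by
  -- every vertex is represented by the white end of its green edge
  set ρ : W ⊕ B → W := Sum.elim id (Γ.matching .green).symm with hρ
  have key : ∀ e, JoinedBy Γ.perms.1 Γ.perms.2 (ρ (.inl (Γ.white e))) (ρ (.inr (Γ.black e))) := by
    intro e
    change JoinedBy _ _ (Γ.white e) ((Γ.matching .green).symm (Γ.black e))
    rw [← matching_white]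
    cases Γ.colour e with
    | red => exact .rel _ _ (.inl rfl)
    | green => rw [Equiv.symm_apply_apply]; exact .refl _
    | blue => exact .rel _ _ (.inr rfl)
  have hreach : ∀ x y, (SimpleGraph.fromRel (fun x y : W ⊕ B =>
      ∃ e : E, x = Sum.inl (Γ.white e) ∧ y = Sum.inr (Γ.black e))).Reachable x y →
      JoinedBy Γ.perms.1 Γ.perms.2 (ρ x) (ρ y) := by
    rintro x y ⟨p⟩
    induction p with
    | nil => exact .refl _
    | cons h _ ih =>
      refine .trans _ _ _ ?_ ih
      rw [SimpleGraph.fromRel_adj] at h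
      rcases h.2 with ⟨e, rfl, rfl⟩ | ⟨e, rfl, rfl⟩
      · exact key e
      · exact .symm _ _ (key e)
  refine ⟨Γ.connected.nonempty.map ρ, fun x y => hreach (.inl x) (.inl y) ?_⟩
  exact Γ.connected.preconnected _ _

theorem Iso.matching_comm {Γ : BelyiGraph W B E} {Γ' : BelyiGraph W' B' E'} (f : Iso Γ Γ')
    (c : EdgeColour) (w : W) : Γ'.matching c (f.onWhite w) = f.onBlack (Γ.matching c w) := by
  obtain ⟨e, rfl, rfl, he⟩ := Γ.exists_edge c w
  rw [← he, ← f.black_comm, ← f.white_comm, ← f.colour_comm, matching_white]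

theorem Iso.turn_comm {Γ : BelyiGraph W B E} {Γ' : BelyiGraph W' B' E'} (f : Iso Γ Γ')
    (a b : EdgeColour) (w : W) : Γ'.turn a b (f.onWhite w) = f.onWhite (Γ.turn a b w) := by
  rw [← (Γ'.matching b).apply_eq_iff_eq, matching_turn, f.matching_comm, f.matching_comm,
    matching_turn]

/-- A bijection of the white vertices that respects the pairs of permutations extends to an
isomorphism of Belyi graphs. -/
def isoOfPerms {Γ : BelyiGraph W B E} {Γ' : BelyiGraph W' B' E'} (e : W ≃ W')
    (h1 : ∀ w, Γ'.perms.1 (e w) = e (Γ.perms.1 w))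
    (h2 : ∀ w, Γ'.perms.2 (e w) = e (Γ.perms.2 w)) : Iso Γ Γ' where
  onWhite := e
  onBlack := (Γ.matching .green).symm.trans (e.trans (Γ'.matching .green))
  onEdge := Γ.edgeEquivWhite.trans ((e.prodCongr (Equiv.refl _)).trans Γ'.edgeEquivWhite.symm)
  white_comm x := by
    have h := Γ'.edgeEquivWhite.apply_symm_apply (e (Γ.white x), Γ.colour x)
    exact congrArg Prod.fst h
  black_comm x := by
    change Γ'.matching (Γ.colour x) (e (Γ.white x)) =
      Γ'.matching .green (e ((Γ.matching .green).symm (Γ.black x)))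
    rw [← matching_white]
    cases Γ.colour x with
    | red =>
      rw [← Γ'.matching_turn .red .green]
      exact congrArg _ (h1 _)
    | green => rw [Equiv.symm_apply_apply]
    | blue =>
      rw [← Γ'.matching_turn .blue .green]
      exact congrArg _ (h2 _)
  colour_comm x := by
    have h := Γ'.edgeEquivWhite.apply_symm_apply (e (Γ.white x), Γ.colour x)
    exact congrArg Prod.snd h

theorem Iso.ext_of_onWhite {Γ : BelyiGraph W B E} {Γ' : BelyiGraph W' B' E'} {f g : Iso Γ Γ'}
    (h : f.onWhite = g.onWhite) : f = g := by
  have hb : f.onBlack = g.onBlack := by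
    ext x
    obtain ⟨w, rfl⟩ := (Γ.matching .green).surjective x
    rw [← f.matching_comm, ← g.matching_comm, h]
  have he : f.onEdge = g.onEdge := by
    ext x
    apply Γ'.edgeEquivWhite.injective
    rw [edgeEquivWhite_apply, edgeEquivWhite_apply, f.white_comm, g.white_comm, f.colour_comm,
      g.colour_comm, h]
  cases f
  cases g
  simp only at h hb he
  subst h hb he
  rfl

/-- The automorphisms of a Belyi graph form the simultaneous centraliser of its pair of
permutations. -/
theorem card_aut (Γ : BelyiGraph W B E) :
    Nat.card Γ.Aut = Nat.card (MulAction.stabilizer (ConjAct (Perm W)) Γ.perms) := by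
  have hmem : ∀ g : ConjAct (Perm W), g ∈ MulAction.stabilizer (ConjAct (Perm W)) Γ.perms ↔
      (∀ w, Γ.perms.1 (ConjAct.ofConjAct g w) = ConjAct.ofConjAct g (Γ.perms.1 w)) ∧
      ∀ w, Γ.perms.2 (ConjAct.ofConjAct g w) = ConjAct.ofConjAct g (Γ.perms.2 w) := by
    intro g
    rw [MulAction.mem_stabilizer_iff, Prod.ext_iff, Prod.smul_fst, Prod.smul_snd,
      ConjAct.smul_def, ConjAct.smul_def, mul_inv_eq_iff_eq_mul, mul_inv_eq_iff_eq_mul,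
      Equiv.ext_iff, Equiv.ext_iff]
    simp only [Perm.mul_apply, eq_comm]
  refine Nat.card_congr (Equiv.ofBijective (fun f : Γ.Aut => ⟨ConjAct.toConjAct f.onWhite,
    (hmem _).2 ⟨f.turn_comm _ _, f.turn_comm _ _⟩⟩) ⟨?_, ?_⟩)
  · intro f g h
    exact Iso.ext_of_onWhite (congrArg Subtype.val h)
  · rintro ⟨g, hg⟩
    exact ⟨isoOfPerms (ConjAct.ofConjAct g) ((hmem g).1 hg).1 ((hmem g).1 hg).2, rfl⟩

theorem nonempty_iso_iff (Γ : BelyiGraph W B E) (Γ' : BelyiGraph W B' E') :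
    Nonempty (Iso Γ Γ') ↔ Γ'.perms ∈ MulAction.orbit (ConjAct (Perm W)) Γ.perms := by
  rw [MulAction.mem_orbit_iff]
  have hmem : ∀ g : ConjAct (Perm W), g • Γ.perms = Γ'.perms ↔
      (∀ w, Γ'.perms.1 (ConjAct.ofConjAct g w) = ConjAct.ofConjAct g (Γ.perms.1 w)) ∧
      ∀ w, Γ'.perms.2 (ConjAct.ofConjAct g w) = ConjAct.ofConjAct g (Γ.perms.2 w) := by
    intro g
    rw [Prod.ext_iff, Prod.smul_fst, Prod.smul_snd, ConjAct.smul_def, ConjAct.smul_def,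
      mul_inv_eq_iff_eq_mul, mul_inv_eq_iff_eq_mul, Equiv.ext_iff, Equiv.ext_iff]
    simp only [Perm.mul_apply, eq_comm]
  constructor
  · rintro ⟨f⟩
    exact ⟨ConjAct.toConjAct f.onWhite, (hmem _).2 ⟨f.turn_comm _ _, f.turn_comm _ _⟩⟩
  · rintro ⟨g, hg⟩
    exact ⟨isoOfPerms (ConjAct.ofConjAct g) ((hmem g).1 hg).1 ((hmem g).1 hg).2⟩

/-- The matchings of the Belyi graph of a pair of permutations; the green edges identify the black
with the white vertices. -/
def pairMatching (α β : Perm W) : EdgeColour → Perm W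
  | .red => α
  | .green => 1
  | .blue => β

/-- The Belyi graph of a transitive pair of permutations. -/
def ofPair (α β : Perm W) (h : IsTransPair α β) : BelyiGraph W W (W × EdgeColour) where
  colour := Prod.snd
  white := Prod.fst
  black e := pairMatching α β e.2 e.1
  white_proper w c := ⟨(w, c), ⟨rfl, rfl⟩, fun _ he => Prod.ext he.1 he.2⟩
  black_proper x c := by
    refine ⟨((pairMatching α β c).symm x, c), ⟨Equiv.apply_symm_apply _ _, rfl⟩, ?_⟩
    rintro ⟨w, c'⟩ ⟨rfl, rfl⟩
    exact Prod.ext (Equiv.symm_apply_apply _ _).symm rfl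
  connected := by
    set G := SimpleGraph.fromRel (fun x y : W ⊕ W => ∃ e : W × EdgeColour,
      x = Sum.inl e.1 ∧ y = Sum.inr (pairMatching α β e.2 e.1)) with hG
    have hadj : ∀ c w, G.Reachable (.inl w) (.inr (pairMatching α β c w)) := fun c w => by
      refine SimpleGraph.Adj.reachable ?_
      rw [hG, SimpleGraph.fromRel_adj]
      exact ⟨by simp, .inl ⟨(w, c), rfl, rfl⟩⟩
    have hJ : ∀ x y, JoinedBy α β x y → G.Reachable (.inl x) (.inl y) := by
      intro x y hxy
      induction hxy with
      | rel x y h =>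
        rcases h with rfl | rfl
        · exact (hadj .red x).trans (hadj .green _).symm
        · exact (hadj .blue x).trans (hadj .green _).symm
      | refl x => rfl
      | symm x y _ ih => exact ih.symm
      | trans x y z _ _ ih1 ih2 => exact ih1.trans ih2
    have hrep : ∀ x : W ⊕ W, ∃ w, G.Reachable (.inl w) x := by
      rintro (w | w)
      · exact ⟨w, by rfl⟩
      · exact ⟨w, hadj .green w⟩
    refine (SimpleGraph.connected_iff _).2 ⟨fun x y => ?_, ⟨.inl h.1.some⟩⟩
    obtain ⟨w, hw⟩ := hrep x
    obtain ⟨w', hw'⟩ := hrep y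
    exact (hw.symm.trans (hJ w w' (h.2 w w'))).trans hw'

theorem matching_ofPair (α β : Perm W) (h : IsTransPair α β) (c : EdgeColour) :
    (ofPair α β h).matching c = pairMatching α β c := by
  ext w
  exact (ofPair α β h).matching_white (w, c)

theorem perms_ofPair (α β : Perm W) (h : IsTransPair α β) : (ofPair α β h).perms = (α, β) := by
  rw [perms, turn, turn, matching_ofPair, matching_ofPair, matching_ofPair]
  rfl

end BelyiGraph

/-! ### The generating function of Belyi graphs as a sum over transitive pairs -/

section Counting

open Equiv Ser

variable {X : Type} [Fintype X] [DecidableEq X]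

/-- The exponent of the monomial `pairWeight α β`. -/
def pairExponent (α β : Perm X) : Var →₀ ℕ :=
  Finsupp.single Var.s (Fintype.card X) + Finsupp.single Var.u (cycles α).card +
    Finsupp.single Var.v (cycles β).card +
    ∑ O ∈ cycles (α * β⁻¹), Finsupp.single (Var.t O.card.toPNat') 1

theorem pairWeight_eq_monomial (α β : Perm X) :
    pairWeight α β = monomial (pairExponent α β) (1 : ℚ) := by
  have hprod : ∀ A : Finset (Finset X), ∏ O ∈ A, tn O.card =
      monomial (∑ O ∈ A, Finsupp.single (Var.t O.card.toPNat') 1) (1 : ℚ) := by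
    intro A
    induction A using Finset.induction_on with
    | empty => simp [MvPowerSeries.monomial_zero_one]
    | insert a A ha ih =>
      rw [Finset.prod_insert ha, Finset.sum_insert ha, ih, tn, t, X_def, monomial_mul_monomial,
        one_mul]
  rw [pairWeight, cycleWeight, cycleWeight, cycleWeight, Finset.prod_const, Finset.prod_const,
    hprod, s, u, v, X_pow_eq, X_pow_eq, X_pow_eq, monomial_mul_monomial, monomial_mul_monomial,
    monomial_mul_monomial, one_mul, one_mul, one_mul, pairExponent]

theorem coeff_pairWeight (n : Var →₀ ℕ) (α β : Perm X) [Decidable (n = pairExponent α β)] :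
    coeff n (pairWeight α β) = if n = pairExponent α β then 1 else 0 := by
  classical
  rw [pairWeight_eq_monomial, coeff_monomial]
  congr

theorem pairExponent_s (α β : Perm X) : pairExponent α β Var.s = Fintype.card X := by
  simp [pairExponent]

theorem pairExponent_u (α β : Perm X) : pairExponent α β Var.u = (cycles α).card := by
  simp [pairExponent]

theorem pairExponent_v (α β : Perm X) : pairExponent α β Var.v = (cycles β).card := by
  simp [pairExponent]

theorem pairExponent_t (α β : Perm X) (i : ℕ+) : pairExponent α β (Var.t i) =
    ((cycles (α * β⁻¹)).filter fun O => O.card = (i : ℕ)).card := by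
  classical
  rw [Finset.card_filter]
  simp only [pairExponent, Finsupp.add_apply, Finsupp.finsetSum_apply]
  rw [Finsupp.single_eq_of_ne (by simp), Finsupp.single_eq_of_ne (by simp),
    Finsupp.single_eq_of_ne (by simp), zero_add, zero_add, zero_add]
  refine Finset.sum_congr rfl fun O hO => ?_
  have h : Var.t O.card.toPNat' = Var.t i ↔ O.card = (i : ℕ) := by
    rw [Var.t.injEq, ← PNat.coe_inj, Nat.toPNat'_coe, if_pos (card_pos_of_mem_cycles hO)]
  rw [Finsupp.single_apply]
  exact if_congr h rfl rfl

theorem card_filter_cycles_conj (τ γ : Perm X) (k : ℕ) :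
    ((cycles (τ * γ * τ⁻¹)).filter fun O => O.card = k).card =
      ((cycles γ).filter fun O => O.card = k).card := by
  rw [show τ * γ * τ⁻¹ = Equiv.permCongr τ γ from rfl, cycles_permCongr, Finset.filter_image,
    Finset.card_image_of_injective _ (Finset.map_injective _)]
  simp

/-- The type of a Belyi graph is the exponent of the monomial of its pair of permutations. -/
theorem BelyiGraph.hasType_iff {B E : Type} (Γ : BelyiGraph X B E) (n : Var →₀ ℕ)
    (hn : n Var.s = Fintype.card X) :
    Γ.HasType (n Var.u) (n Var.v) (fun i => n (Var.t i)) ↔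
      n = pairExponent Γ.perms.1 Γ.perms.2 := by
  have h2 : cycles (Γ.turn .green .blue) = cycles Γ.perms.2 := by
    rw [← cycles_inv]
    rfl
  have h3 : Γ.perms.1 * Γ.perms.2⁻¹ = Γ.perms.2 * Γ.turn .red .blue * Γ.perms.2⁻¹ := by
    congr 1
    ext w
    simp [perms, turn]
  rw [HasType, card_cycle, card_cycle, h2]
  simp only [card_cycle_length Γ (a := .red) (b := .blue) (by simp)]
  constructor
  · rintro ⟨hu, hv, ht⟩
    ext x
    cases x with
    | s => rw [pairExponent_s, hn]
    | u => rw [pairExponent_u, ← hu]; rfl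
    | v => rw [pairExponent_v, ← hv]
    | t i => rw [pairExponent_t, h3, card_filter_cycles_conj, ← ht]
  · intro h
    refine ⟨?_, ?_, fun i => ?_⟩
    · rw [h, pairExponent_u]; rfl
    · rw [h, pairExponent_v]
    · rw [h, pairExponent_t, h3, card_filter_cycles_conj]

theorem pairWeight_smul (g : ConjAct (Perm X)) (π : Perm X × Perm X) :
    pairWeight (g • π).1 (g • π).2 = pairWeight π.1 π.2 :=
  pairWeight_permCongr (ConjAct.ofConjAct g) π.1 π.2

theorem isTransPair_iff_exists_class {d : ℕ} (π : Perm (Fin d) × Perm (Fin d)) :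
    IsTransPair π.1 π.2 ↔ ∃ c : BelyiClass d,
      π ∈ MulAction.orbit (ConjAct (Perm (Fin d))) c.out.perms := by
  constructor
  · intro h
    have e : Fin d × EdgeColour ≃ Fin (3 * d) := Finite.equivFinOfCardEq (by
      rw [Nat.card_prod, EdgeColour.card_eq, Nat.card_fin, mul_comm])
    set Γ := BelyiGraph.ofPair π.1 π.2 h with hΓ
    set Γ' := Γ.map (Equiv.refl _) (Equiv.refl _) e with hΓ'
    refine ⟨⟦Γ'⟧, ?_⟩
    obtain ⟨f⟩ : Nonempty (BelyiGraph.Iso (⟦Γ'⟧ : BelyiClass d).out Γ') := Quotient.mk_out Γ'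
    have f' : BelyiGraph.Iso Γ Γ' :=
      ⟨Equiv.refl _, Equiv.refl _, e, by simp [Γ', BelyiGraph.map], by simp [Γ', BelyiGraph.map],
        by simp [Γ', BelyiGraph.map]⟩
    have h1 := (BelyiGraph.nonempty_iso_iff _ _).1 ⟨f.trans f'.symm⟩
    rwa [hΓ, BelyiGraph.perms_ofPair] at h1
  · rintro ⟨c, g, rfl⟩
    exact (isTransPair_permCongr (ConjAct.ofConjAct g) _ _).2 (BelyiGraph.isTransPair_perms _)

theorem class_eq_of_mem_orbit {d : ℕ} {c c' : BelyiClass d} {π : Perm (Fin d) × Perm (Fin d)}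
    (h : π ∈ MulAction.orbit (ConjAct (Perm (Fin d))) c.out.perms)
    (h' : π ∈ MulAction.orbit (ConjAct (Perm (Fin d))) c'.out.perms) : c = c' := by
  have h1 : c'.out.perms ∈ MulAction.orbit (ConjAct (Perm (Fin d))) c.out.perms := by
    rw [← MulAction.orbit_eq_iff.2 h, MulAction.orbit_eq_iff.2 h']
    exact MulAction.mem_orbit_self _
  exact Quotient.out_equiv_out.1 ((BelyiGraph.nonempty_iso_iff _ _).2 h1)

/-- Orbit-stabiliser: the `d!` relabelings of a Belyi graph yield `d! / |Aut Γ|` pairs. -/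
theorem card_orbit_perms {d : ℕ} {B E : Type} (Γ : BelyiGraph (Fin d) B E) :
    (Nat.card (MulAction.orbit (ConjAct (Perm (Fin d))) Γ.perms) : ℚ) =
      (d.factorial : ℚ) * (1 / (Nat.card Γ.Aut : ℚ)) := by
  have h := Nat.card_congr (MulAction.orbitProdStabilizerEquivGroup (ConjAct (Perm (Fin d))) Γ.perms)
  rw [Nat.card_prod, ← Γ.card_aut] at h
  have hcard : Nat.card (ConjAct (Perm (Fin d))) = d.factorial := by
    rw [Nat.card_congr ConjAct.ofConjAct.toEquiv, Nat.card_eq_fintype_card, Fintype.card_perm,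
      Fintype.card_fin]
  rw [hcard] at h
  have hne : (Nat.card Γ.Aut : ℚ) ≠ 0 := by
    intro h0
    rw [Nat.cast_eq_zero.1 h0, mul_zero] at h
    exact d.factorial_ne_zero h.symm
  rw [mul_one_div, eq_div_iff hne]
  exact_mod_cast h

/-- The coefficients of the generating function count transitive pairs of permutations. -/
theorem coeff_totalGF (n : Var →₀ ℕ) : coeff n totalGF =
    ((n Var.s).factorial : ℚ)⁻¹ * coeff n (transPairSum (Fin (n Var.s))) := by
  classical
  set d := n Var.s with hd
  have : Fintype (BelyiClass d) := Fintype.ofFinite _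
  set orb : BelyiClass d → Finset (Perm (Fin d) × Perm (Fin d)) := fun c =>
    Finset.univ.filter (· ∈ MulAction.orbit (ConjAct (Perm (Fin d))) c.out.perms) with horb
  have hunion : (Finset.univ.filter fun π : Perm (Fin d) × Perm (Fin d) =>
      IsTransPair π.1 π.2) = Finset.univ.biUnion orb := by
    ext π
    simp [horb, isTransPair_iff_exists_class]
  have hterm : ∀ c : BelyiClass d, ∑ π ∈ orb c, coeff n (pairWeight π.1 π.2) =
      (d.factorial : ℚ) * if c ∈ belyiClassesOfType d (n Var.u) (n Var.v) (fun i => n (Var.t i))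
        then 1 / (Nat.card c.out.Aut : ℚ) else 0 := by
    intro c
    have hconst : ∀ π ∈ orb c, coeff n (pairWeight π.1 π.2) =
        coeff n (pairWeight c.out.perms.1 c.out.perms.2) := by
      intro π hπ
      obtain ⟨g, rfl⟩ := (Finset.mem_filter.1 hπ).2
      rw [← pairWeight_smul g c.out.perms]
    have hcard : ((orb c).card : ℚ) = (d.factorial : ℚ) * (1 / (Nat.card c.out.Aut : ℚ)) := by
      rw [← card_orbit_perms, ← Nat.subtype_card (orb c) fun π => by
        rw [horb, Finset.mem_filter, and_iff_right (Finset.mem_univ π)]]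
    rw [Finset.sum_congr rfl hconst, Finset.sum_const, nsmul_eq_mul, hcard, coeff_pairWeight]
    have hiff : c ∈ belyiClassesOfType d (n Var.u) (n Var.v) (fun i => n (Var.t i)) ↔
        n = pairExponent c.out.perms.1 c.out.perms.2 :=
      BelyiGraph.hasType_iff c.out n (by rw [Fintype.card_fin])
    by_cases h : n = pairExponent c.out.perms.1 c.out.perms.2
    · rw [if_pos h, if_pos (hiff.2 h), mul_one]
    · rw [if_neg h, if_neg (mt hiff.1 h), mul_zero, mul_zero]
  rw [transPairSum, map_sum, hunion, Finset.sum_biUnion, Finset.sum_congr rfl fun c _ => hterm c,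
    ← Finset.mul_sum, inv_mul_cancel_left₀ (by exact_mod_cast d.factorial_ne_zero)]
  · change weightedCount d (n Var.u) (n Var.v) (fun i => n (Var.t i)) = _
    rw [weightedCount, finsum_mem_def, finsum_eq_sum_of_fintype]
    refine Finset.sum_congr rfl fun c _ => ?_
    rw [Set.indicator_apply]
  · intro c _ c' _ hcc'
    rw [Function.onFun, Finset.disjoint_left]
    intro π hπ hπ'
    exact hcc' (class_eq_of_mem_orbit (Finset.mem_filter.1 hπ).2 (Finset.mem_filter.1 hπ').2)

theorem orderGE_totalGF : OrderGE 1 totalGF := by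
  classical
  intro n hn
  rw [coeff_totalGF, transPairSum, Finset.sum_eq_zero, map_zero, mul_zero]
  intro π hπ
  have h : IsTransPair π.1 π.2 := (Finset.mem_filter.1 hπ).2
  obtain ⟨x⟩ := h.1
  exact absurd x.2 (by omega)

theorem exp_totalGF : Ser.exp totalGF = Ser.opExp Ser.generator 1 :=
  exp_eq_opExp_of_convolution (A := fun d => pairSum (Fin d))
    (C := fun d => transPairSum (Fin d)) orderGE_totalGF pairSum_fin coeff_totalGF
    pairSum_fin_succ

end Counting

end

theorem theorem1 :
    -- the generating function satisfies the evolution equation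
    Ser.EvolutionEquation totalGF ∧
    -- it is the only solution with the initial condition
    (Ser.atZero totalGF = 0 ∧
      ∀ G : Ser, Ser.EvolutionEquation G → Ser.atZero G = 0 → G = totalGF) ∧
    -- the explicit formula for the partition function
    Ser.exp totalGF = Ser.opExp Ser.generator 1 ∧
    -- the equation and the formula are equivalent
    (∀ G : Ser, Ser.atZero G = 0 →
      (Ser.EvolutionEquation G ↔ Ser.exp G = Ser.opExp Ser.generator 1)) := by
  refine ⟨(Ser.evolutionEquation_iff orderGE_totalGF).2 exp_totalGF,
    ⟨Ser.orderGE_one_iff.1 orderGE_totalGF, fun G hG h0 => ?_⟩, exp_totalGF,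
    fun G h0 => Ser.evolutionEquation_iff (Ser.orderGE_one_iff.2 h0)⟩
  have h1 := Ser.orderGE_one_iff.2 h0
  exact Ser.exp_injective h1 orderGE_totalGF
    (((Ser.evolutionEquation_iff h1).1 hG).trans exp_totalGF.symm)
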